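/- **Setting.** A *cardinality minimization problem* $\mathcal P$ assigns to every $n\in\mathbb N$ and every bit string $C$ (the description of the constraints) a family of *feasible* subsets of the $n$-element ground set $\mathcal U=\{0,\dots,n-1\}$; as a decision problem it asks, given $(n,C,k)$ with $n$ and $k$ in unary (the ground set is listed explicitly), whether there is a feasible set with at most $k$ elements. Assume that every instance $(n,C)$ has a feasible set, or else that it can be checked in polynomial time whether a given set is feasible for given constraints. In *online min-max-$\mathcal P$* an instance $(n,C)$ with a nonempty family $\mathcal X$ of feasible sets is fixed. In every round $t=1,2,\dots$ the algorithm chooses $x^t\in\mathcal X$, then rational weights $w^t:\mathcal U\to[0,1]$ are revealed, and the cost of the round is $f^t(x^t)=\max_{u\in x^t}w^t(u)$ (with $\max\emptyset=0$). The weights are fixed in advance (oblivious adversary). A *polynomial-time vanishing regret algorithm* for online min-max-$\mathcal P$ is a randomized algorithm such that 1. on every instance $(n,C)$ the set $x^t\subseteq\mathcal U$ is computed from $n$, $C$, $t$, the weights of the previous rounds and a number of fair coin flips that is polynomial in $n+|C|+t$, in time polynomial in the length of these data, and $x^t$ is feasible for all outcomes of the coins whenever the instance has a feasible set; 2. there are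 a polynomial $p$ and a constant $0\le c<1$ such that for every instance $(n,C)$ with a feasible set, every sequence of weights and every $T\ge 0$, $$\mathbb E\Big[\sum_{t=1}^T f^t(x^t)\Big]-\min_{x\in\mathcal X}\sum_{t=1}^T f^t(x)\;\le\; p(n+|C|)\,T^{c}.$$ Running times are numbers of elementary steps of a multi-stack machine; $NP$, $RP$ and $NP$-completeness (under polynomial-time many-one reductions) are defined as usual for languages over $\{0,1\}$. **Statement.** If $\mathcal P$ is $NP$-complete and $NP\neq RP$, then there is no polynomial-time vanishing regret algorithm for online min-max-$\mathcal P$. -/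

import Mathlib

open scoped BigOperators

/-! ## A machine model with a step count

Programs act on finitely many stacks of bits, addressed by natural numbers.  An elementary step
pushes a bit, pops a bit, or tests the top of one stack. -/

/-- The contents of the stacks. -/
abbrev Store : Type := ℕ → List Bool

/-- Structured multi-stack programs. `branch v c d e` executes `c`, `d` or `e` according to whether
stack `v` is empty, has `false` on top, or has `true` on top; `loop v c` repeats `c` as long as
stack `v` is not empty. -/
inductive Cmd : Type
  | skip : Cmd
  | push (v : ℕ) (b : Bool) : Cmd
  | pop (v : ℕ) : Cmd
  | seq (c d : Cmd) : Cmd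
  | branch (v : ℕ) (c d e : Cmd) : Cmd
  | loop (v : ℕ) (c : Cmd) : Cmd

/-- `Run c s s' τ`: started on the store `s`, the program `c` halts with the store `s'` after
exactly `τ` elementary steps. -/
inductive Run : Cmd → Store → Store → ℕ → Prop
  | skip (s : Store) : Run Cmd.skip s s 1
  | push (v : ℕ) (b : Bool) (s : Store) :
      Run (Cmd.push v b) s (Function.update s v (b :: s v)) 1
  | pop (v : ℕ) (s : Store) :
      Run (Cmd.pop v) s (Function.update s v (s v).tail) 1
  | seq {c d : Cmd} {s s' s'' : Store} {a b : ℕ} :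
      Run c s s' a → Run d s' s'' b → Run (Cmd.seq c d) s s'' (a + b)
  | branch_nil {v : ℕ} {c d e : Cmd} {s s' : Store} {a : ℕ} :
      s v = [] → Run c s s' a → Run (Cmd.branch v c d e) s s' (a + 1)
  | branch_false {v : ℕ} {c d e : Cmd} {s s' : Store} {a : ℕ} :
      (s v).head? = some false → Run d s s' a → Run (Cmd.branch v c d e) s s' (a + 1)
  | branch_true {v : ℕ} {c d e : Cmd} {s s' : Store} {a : ℕ} :
      (s v).head? = some true → Run e s s' a → Run (Cmd.branch v c d e) s s' (a + 1)
  | loop_done {v : ℕ} {c : Cmd} {s : Store} :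
      s v = [] → Run (Cmd.loop v c) s s 1
  | loop_step {v : ℕ} {c : Cmd} {s s' s'' : Store} {a b : ℕ} :
      s v ≠ [] → Run c s s' a → Run (Cmd.loop v c) s' s'' b →
        Run (Cmd.loop v c) s s'' (a + b + 1)

/-- The initial store: the inputs are on stacks `0, 1, 2, …`, all other stacks are empty. -/
def initStore (xs : List (List Bool)) : Store := fun i => xs.getD i []

/-- The total number of input bits. -/
def inputSize (xs : List (List Bool)) : ℕ := (xs.map List.length).sum

/-- Some program, started on the input strings `inp a`, halts with `out a` on stack `0`, within a
number of steps that is polynomial in the number of input bits, for every `a ∈ D`. -/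
def PolyTimeOn {α : Type} (D : Set α) (inp : α → List (List Bool)) (out : α → List Bool) : Prop :=
  ∃ (c : Cmd) (p : Polynomial ℕ), ∀ a ∈ D, ∃ (s : Store) (τ : ℕ),
    Run c (initStore (inp a)) s τ ∧ s 0 = out a ∧ τ ≤ p.eval (inputSize (inp a))

/-- Polynomial-time computable functions on bit strings. -/
def PolyTimeFun (f : List Bool → List Bool) : Prop :=
  PolyTimeOn Set.univ (fun x => [x]) f

/-- Polynomial-time decidable binary relations on bit strings. -/
def PolyTimeRel (V : List Bool → List Bool → Bool) : Prop :=
  PolyTimeOn (Set.univ : Set (List Bool × List Bool)) (fun a => [a.1, a.2]) (fun a => [V a.1 a.2])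

/-! ## Complexity classes -/

/-- `NP`: languages with polynomial-time checkable certificates of polynomial length. -/
def NP : Set (Set (List Bool)) :=
  {L | ∃ (V : List Bool → List Bool → Bool) (p : Polynomial ℕ), PolyTimeRel V ∧
    ∀ x, x ∈ L ↔ ∃ y : Fin (p.eval x.length) → Bool, V x (List.ofFn y) = true}

/-- `RP`: a polynomial-time test with polynomially many fair coins accepts every `x ∈ L` with
probability at least `1 / 2` and never accepts an `x ∉ L`. -/
def RP : Set (Set (List Bool)) :=
  {L | ∃ (V : List Bool → List Bool → Bool) (p : Polynomial ℕ), PolyTimeRel V ∧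
    ∀ x,
      (x ∈ L → 1 / 2 ≤ (Finset.univ.filter
        (fun r : Fin (p.eval x.length) → Bool => V x (List.ofFn r) = true)).dens) ∧
      (x ∉ L → ∀ r : Fin (p.eval x.length) → Bool, V x (List.ofFn r) = false)}

/-- Polynomial-time many-one reducibility. -/
def PolyTimeReduces (L L' : Set (List Bool)) : Prop :=
  ∃ f : List Bool → List Bool, PolyTimeFun f ∧ ∀ x, x ∈ L ↔ f x ∈ L'

def NPComplete (L : Set (List Bool)) : Prop :=
  L ∈ NP ∧ ∀ L' ∈ NP, PolyTimeReduces L' L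

/-! ## Encodings -/

def unary (n : ℕ) : List Bool := List.replicate n true

/-- Self-delimiting encoding of a list of strings: every bit is preceded by `true`, and every
string is terminated by `false`. -/
def encList (xs : List (List Bool)) : List Bool :=
  xs.flatMap fun x => (x.flatMap fun b => [true, b]) ++ [false]

/-- A subset of `{0, …, n - 1}` as its characteristic vector. -/
def encSet {n : ℕ} (S : Finset (Fin n)) : List Bool := List.ofFn fun i => decide (i ∈ S)

/-- A list of weight vectors, with every weight given by its numerator and denominator in
binary. -/
def encHistory {n : ℕ} (hist : List (Fin n → ℚ≥0)) : List Bool :=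
  encList (hist.flatMap fun w =>
    (List.finRange n).flatMap fun i => [Nat.bits (w i).num, Nat.bits (w i).den])

/-! ## Cardinality minimization problems -/

/-- A cardinality minimization problem: `P n C` is the set of those subsets of the `n`-element
ground set `{0, …, n - 1}` that satisfy the constraints described by the bit string `C`. -/
def CardinalityProblem : Type := (n : ℕ) → List Bool → Set (Finset (Fin n))

namespace CardinalityProblem

/-- The decision problem: given the ground set, the constraints and `k`, is there a feasible set
with at most `k` elements?  (The ground set is listed explicitly, hence `n` is in unary; `k` is in
unary too, since only the values `k ≤ n` matter.) -/
def language (P : CardinalityProblem) : Set (List Bool) :=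
  {x | ∃ (n : ℕ) (C : List Bool) (k : ℕ), x = encList [unary n, C, unary k] ∧
    ∃ S ∈ P n C, S.card ≤ k}

/-- The instance `(n, C)` has a feasible solution. -/
def Feasible (P : CardinalityProblem) (n : ℕ) (C : List Bool) : Prop := (P n C).Nonempty

open Classical in
/-- Whether a given set satisfies given constraints can be decided in polynomial time. -/
def PolyTimeCheckable (P : CardinalityProblem) : Prop :=
  PolyTimeOn (Set.univ : Set (Σ n : ℕ, List Bool × Finset (Fin n)))
    (fun a => [unary a.1, a.2.1, encSet a.2.2])
    (fun a => [decide (a.2.2 ∈ P a.1 a.2.1)])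

end CardinalityProblem

/-! ## Online min-max problems -/

/-- The cost of `S` under the weights `w`: the maximum weight of an element of `S`
(`0` if `S` is empty). -/
noncomputable def maxCost {n : ℕ} (w : Fin n → ℚ≥0) (S : Finset (Fin n)) : ℝ :=
  ((S.sup w : ℚ≥0) : ℝ)

/-- All weights are at most `1`. -/
def Normalized {n : ℕ} (w : Fin n → ℚ≥0) : Prop := ∀ i, w i ≤ 1

/-- A randomized online learning algorithm. On an instance `(n, C)`, after the weights `hist` of
the previous rounds have been revealed, it plays `act n C hist r`, where `r` consists of the first
`coinCount n C hist.length` bits of one sequence of independent fair coins (the same sequence in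
all rounds, so that earlier random choices can be remembered). The number of coins is polynomial in
the size of the instance and the number of the round. -/
structure OnlineAlgorithm : Type where
  act : (n : ℕ) → List Bool → List (Fin n → ℚ≥0) → List Bool → Finset (Fin n)
  coins : Polynomial ℕ

/-- The size of the instance `(n, C)`. -/
def instanceSize (n : ℕ) (C : List Bool) : ℕ := n + C.length

namespace OnlineAlgorithm

def coinCount (A : OnlineAlgorithm) (n : ℕ) (C : List Bool) (t : ℕ) : ℕ :=
  A.coins.eval (instanceSize n C + t)

/-- The set played after `t` rounds with weights `w 0, …, w (t - 1)`, on the coin sequence `r`. -/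
def play (A : OnlineAlgorithm) (n : ℕ) (C : List Bool) (w : ℕ → Fin n → ℚ≥0) (r : List Bool)
    (t : ℕ) : Finset (Fin n) :=
  A.act n C (List.ofFn fun s : Fin t => w s) (r.take (A.coinCount n C t))

/-- The expected regret over `T` rounds against the oblivious weight sequence `w`: the expected
total cost minus the total cost of the best fixed feasible solution. -/
noncomputable def expectedRegret (A : OnlineAlgorithm) (P : CardinalityProblem) (n : ℕ)
    (C : List Bool) (w : ℕ → Fin n → ℚ≥0) (T : ℕ) : ℝ :=
  (𝔼 r : Fin (A.coinCount n C T) → Bool,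
      ∑ t ∈ Finset.range T, maxCost (w t) (A.play n C w (List.ofFn r) t))
    - ⨅ S : {S : Finset (Fin n) // S ∈ P n C}, ∑ t ∈ Finset.range T, maxCost (w t) S.1

/-- A situation in which the algorithm has to move: an instance, the weights of the previous
rounds, and the coins. -/
structure Situation : Type where
  n : ℕ
  C : List Bool
  hist : List (Fin n → ℚ≥0)
  r : List Bool

/-- The situations that can occur: normalized weights and the right number of coins. -/
def Admissible (A : OnlineAlgorithm) : Set Situation :=
  {a | (∀ w ∈ a.hist, Normalized w) ∧ a.r.length = A.coinCount a.n a.C a.hist.length}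

/-- The moves are computed in polynomial time from the instance, the number of the round, the
revealed weights and the coins. -/
def PolyTime (A : OnlineAlgorithm) : Prop :=
  PolyTimeOn A.Admissible
    (fun a => [unary a.n, a.C, unary a.hist.length, encHistory a.hist, a.r])
    (fun a => encSet (A.act a.n a.C a.hist a.r))

/-- The moves are feasible solutions, if there are any. -/
def PlaysFeasible (A : OnlineAlgorithm) (P : CardinalityProblem) : Prop :=
  ∀ a ∈ A.Admissible, P.Feasible a.n a.C → A.act a.n a.C a.hist a.r ∈ P a.n a.C

/-- The expected regret is at most `p(size) * T ^ c` for a polynomial `p` and some `0 ≤ c < 1`. -/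
def VanishingRegret (A : OnlineAlgorithm) (P : CardinalityProblem) : Prop :=
  ∃ (p : Polynomial ℕ) (c : ℝ), 0 ≤ c ∧ c < 1 ∧
    ∀ (n : ℕ) (C : List Bool), P.Feasible n C →
      ∀ w : ℕ → Fin n → ℚ≥0, (∀ t, Normalized (w t)) →
        ∀ T : ℕ, A.expectedRegret P n C w T ≤ ((p.eval (instanceSize n C) : ℕ) : ℝ) * (T : ℝ) ^ c

/-- `A` is a polynomial-time vanishing regret algorithm for the online min-max version of `P`. -/
def IsPolyTimeVanishingRegret (A : OnlineAlgorithm) (P : CardinalityProblem) : Prop :=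
  A.PolyTime ∧ A.PlaysFeasible P ∧ A.VanishingRegret P

end OnlineAlgorithm

/-! A vanishing regret algorithm is turned into a one-sided-error randomized test for the
cardinality problem. Let `M = 2 ^ m` be the least power of two that is at least the length of the
encoded instance, so `n ≤ M`. In every round draw a number below `M` uniformly and let the weights
be `1` at that position and `0` elsewhere (all `0` if the number is not below `n`). With only one
nonzero weight the maximum is as good as a sum, so a set `S` chosen independently of the current
draw has expected cost `|S| / M` (`coinAvg_maxCost_oneHot`, `coinAvg_maxCost_blockWeights`).

The regret bound `R` holds for every fixed weight sequence, hence on average over these sequences.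
Comparing with a feasible set of minimum cardinality `k₀` gives `∑ E (|x^t| - k₀) ≤ M R`. Every move
is feasible, so each summand averages a nonnegative integer, which is at least `1` whenever `|x^t| >
k ≥ k₀`. Hence the expected number of rounds with `|x^t| > k` is at most `M R`
(`sum_coinAvg_card_gt_le`). With `R = p(M) T ^ c`, `c < 1` and `T = M ^ d` for a large constant `d`,
this is at most `T / 2` (`exists_pow_dominates`). So in a uniformly random round the move is, with
probability at least `1 / 2`, a feasible set with at most `k` elements
(`half_le_coinAvg_randomMove`).

The test simulates the algorithm in one such round and accepts if it sees such a set; accepting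
exhibits a witness, so there are no false positives. Thus every language reducible to the problem is
in `RP`, and `NP = RP` follows with `RP_subset_NP`. As `M` and `T` are powers of two, all uniform
draws are exact with fair coins.

The remaining work is to show that the test runs in polynomial time on the stack machine.
Composition and polynomially bounded loops are established once at machine level (`PolyTimeOn.comp`,
`PolyTimeOn.iterate`); from then on polynomial-time computability is derived from the closure
properties of `PolyFun`, without mentioning programs except for a few one-line primitives. -/

/-! ## Machine-level facts -/

/-- A strict upper bound for the stacks that a program mentions. -/
def Cmd.bound : Cmd → ℕ
  | .skip => 0
  | .push v _ => v + 1
  | .pop v => v + 1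
  | .seq c d => max c.bound d.bound
  | .branch v c d e => max (v + 1) (max c.bound (max d.bound e.bound))
  | .loop v c => max (v + 1) c.bound

/-- The store that agrees with `s` below `B` and with `u` from `B` on. -/
def Store.merge (B : ℕ) (s u : Store) : Store := fun v => if v < B then s v else u v

theorem Store.merge_apply (B : ℕ) (s u : Store) (v : ℕ) :
    Store.merge B s u v = if v < B then s v else u v := rfl

theorem Store.merge_update {B v : ℕ} (hv : v < B) (s u : Store) (x : List Bool)
    (h : ∀ v < B, u v = s v) :
    Store.merge B (Function.update s v x) u = Function.update u v x := by
  funext w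
  simp only [Store.merge, Function.update_apply]
  split_ifs with h1 h2 h2
  · rfl
  · exact (h w h1).symm
  · omega
  · rfl

/-- A program neither reads nor changes stacks from its bound on. This is what allows an arbitrary
program to be used as a subroutine while other data are stored on high stacks. -/
theorem Run.frame {c : Cmd} {s s' : Store} {τ : ℕ} (h : Run c s s' τ) (B : ℕ) :
    c.bound ≤ B → ∀ u : Store, (∀ v < B, u v = s v) → Run c u (Store.merge B s' u) τ := by
  have self : ∀ s u : Store, (∀ v < B, u v = s v) → Store.merge B s u = u := by
    intro s u h
    funext v
    simp only [Store.merge]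
    split_ifs with hv
    · exact (h v hv).symm
    · rfl
  have merge2 : ∀ s s' u : Store,
      Store.merge B s (Store.merge B s' u) = Store.merge B s u := by
    intro s s' u
    funext v
    simp only [Store.merge]
    split_ifs <;> rfl
  have agree : ∀ s u : Store, ∀ v < B, Store.merge B s u v = s v := by
    intro s u v hv
    simp [Store.merge, hv]
  induction h with
  | skip s => intro _ u hu; rw [self s u hu]; exact Run.skip u
  | push v b s =>
    intro hB u hu
    have hv : v < B := hB
    rw [Store.merge_update hv s u _ hu, ← hu v hv]
    exact Run.push v b u
  | pop v s =>
    intro hB u hu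
    have hv : v < B := hB
    rw [Store.merge_update hv s u _ hu, ← hu v hv]
    exact Run.pop v u
  | seq _ _ ih1 ih2 =>
    intro hB u hu
    simp only [Cmd.bound, max_le_iff] at hB
    have h2 := ih2 hB.2 _ (agree _ u)
    rw [merge2] at h2
    exact Run.seq (ih1 hB.1 u hu) h2
  | branch_nil hv _ ih =>
    intro hB u hu
    simp only [Cmd.bound, max_le_iff] at hB
    exact Run.branch_nil (by rw [hu _ hB.1]; exact hv) (ih hB.2.1 u hu)
  | branch_false hv _ ih =>
    intro hB u hu
    simp only [Cmd.bound, max_le_iff] at hB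
    exact Run.branch_false (by rw [hu _ hB.1]; exact hv) (ih hB.2.2.1 u hu)
  | branch_true hv _ ih =>
    intro hB u hu
    simp only [Cmd.bound, max_le_iff] at hB
    exact Run.branch_true (by rw [hu _ hB.1]; exact hv) (ih hB.2.2.2 u hu)
  | loop_done hv =>
    intro hB u hu
    simp only [Cmd.bound, max_le_iff] at hB
    rw [self _ u hu]
    exact Run.loop_done (by rw [hu _ hB.1]; exact hv)
  | loop_step hv _ _ ih1 ih2 =>
    intro hB u hu
    have hB' := hB
    simp only [Cmd.bound, max_le_iff] at hB
    have h2 := ih2 hB' _ (agree _ u)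
    rw [merge2] at h2
    exact Run.loop_step (by rw [hu _ hB.1]; exact hv) (ih1 hB.2 u hu) h2

/-- Each step adds at most one bit to a stack, so a time bound also bounds the size of every stack,
in particular of the output. -/
theorem Run.length_le {c : Cmd} {s s' : Store} {τ : ℕ} (h : Run c s s' τ) (v : ℕ) :
    (s' v).length ≤ (s v).length + τ := by
  induction h with
  | skip s => omega
  | push w b s =>
    by_cases hv : v = w
    · subst hv; simp
    · simp [Function.update_of_ne hv]
  | pop w s =>
    by_cases hv : v = w
    · subst hv; simp; omega
    · simp [Function.update_of_ne hv]
  | seq _ _ ih1 ih2 => omega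
  | branch_nil _ _ ih => omega
  | branch_false _ _ ih => omega
  | branch_true _ _ ih => omega
  | loop_done _ => omega
  | loop_step _ _ _ ih1 ih2 => omega

theorem Run.cast {c : Cmd} {s s₁ s₂ : Store} {a b : ℕ} (h : Run c s s₁ a) (hs : s₁ = s₂)
    (hab : a = b) : Run c s s₂ b := hs ▸ hab ▸ h

/-! ### Elementary programs: clearing, moving and copying stacks -/

/-- Empty a stack. -/
def Cmd.clear (v : ℕ) : Cmd := .loop v (.pop v)

theorem Run.clear (v : ℕ) (s : Store) :
    Run (Cmd.clear v) s (Function.update s v []) (2 * (s v).length + 1) := by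
  suffices H : ∀ (l : List Bool) (s : Store), s v = l →
      Run (Cmd.clear v) s (Function.update s v []) (2 * l.length + 1) from H _ s rfl
  intro l
  induction l with
  | nil =>
    intro s hs
    rw [← hs, Function.update_eq_self, hs]
    exact Run.loop_done hs
  | cons b l ih =>
    intro s hs
    have h1 := Run.pop v s
    have h2 := ih (Function.update s v (s v).tail) (by simp [hs])
    rw [Function.update_idem] at h2
    exact (Run.loop_step (by simp [hs]) h1 h2).cast rfl (by simp only [List.length_cons]; ring)

/-- Empty `k` consecutive stacks. -/
def Cmd.clearRange (lo : ℕ) : ℕ → Cmd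
  | 0 => .skip
  | k + 1 => .seq (Cmd.clearRange lo k) (.clear (lo + k))

theorem Run.clearRange (lo k N : ℕ) (s : Store) (hN : ∀ i < k, (s (lo + i)).length ≤ N) :
    ∃ τ ≤ k * (2 * N + 1) + 1, Run (Cmd.clearRange lo k) s
      (fun v => if lo ≤ v ∧ v < lo + k then [] else s v) τ := by
  induction k with
  | zero =>
    refine ⟨1, by omega, (Run.skip s).cast ?_ rfl⟩
    funext v
    rw [if_neg (by omega)]
  | succ k ih =>
    obtain ⟨τ, hτ, h⟩ := ih fun i hi => hN i (by omega)
    have h2 := Run.clear (lo + k) (fun v => if lo ≤ v ∧ v < lo + k then [] else s v)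
    have h3 := Run.seq h h2
    have hl : ((fun v => if lo ≤ v ∧ v < lo + k then ([] : List Bool) else s v)
        (lo + k)).length ≤ N := by
      simpa using hN k (by omega)
    refine ⟨_, ?_, h3.cast ?_ rfl⟩
    · nlinarith
    · funext v
      by_cases hv : v = lo + k
      · subst hv; simp
      · rw [Function.update_of_ne hv]
        have : (lo ≤ v ∧ v < lo + (k + 1)) ↔ (lo ≤ v ∧ v < lo + k) := by omega
        simp only [this]

/-- Move a stack to another one, reversing it. -/
def Cmd.moveRev (v w : ℕ) : Cmd :=
  .loop v (.branch v .skip (.seq (.push w false) (.pop v)) (.seq (.push w true) (.pop v)))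

theorem Run.moveRev {v w : ℕ} (hvw : v ≠ w) (s : Store) :
    Run (Cmd.moveRev v w) s
      (Function.update (Function.update s w ((s v).reverse ++ s w)) v [])
      (4 * (s v).length + 1) := by
  suffices H : ∀ (l : List Bool) (s : Store), s v = l →
      Run (Cmd.moveRev v w) s
        (Function.update (Function.update s w (l.reverse ++ s w)) v [])
        (4 * l.length + 1) from H _ s rfl
  intro l
  induction l with
  | nil =>
    intro s hs
    simp only [List.reverse_nil, List.nil_append, Function.update_eq_self]
    rw [← hs, Function.update_eq_self, hs]
    exact Run.loop_done hs
  | cons b l ih =>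
    intro s hs
    have h1 := Run.seq (Run.push w b s) (Run.pop v _)
    rw [Function.update_of_ne hvw, hs, List.tail_cons] at h1
    have h2 := ih _ (show (Function.update (Function.update s w (b :: s w)) v l) v = l by simp)
    have h1' : Run (.branch v .skip (.seq (.push w false) (.pop v))
        (.seq (.push w true) (.pop v))) s
        (Function.update (Function.update s w (b :: s w)) v l) 3 := by
      cases b
      · exact Run.branch_false (by simp [hs]) h1
      · exact Run.branch_true (by simp [hs]) h1
    have h3 := Run.loop_step (by simp [hs]) h1' h2
    refine h3.cast ?_ ?_
    · funext u
      simp only [Function.update_apply]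
      have := hvw.symm
      by_cases h1 : u = v <;> by_cases h2 : u = w <;> simp_all
    · simp only [List.length_cons]; ring

/-- Move a stack to two others, reversing it. -/
def Cmd.moveRev₂ (v w z : ℕ) : Cmd :=
  .loop v (.branch v .skip
    (.seq (.push w false) (.seq (.push z false) (.pop v)))
    (.seq (.push w true) (.seq (.push z true) (.pop v))))

theorem Run.moveRev₂ {v w z : ℕ} (hvw : v ≠ w) (hvz : v ≠ z) (hwz : w ≠ z) (s : Store) :
    Run (Cmd.moveRev₂ v w z) s
      (Function.update (Function.update (Function.update s w ((s v).reverse ++ s w))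
        z ((s v).reverse ++ s z)) v [])
      (5 * (s v).length + 1) := by
  suffices H : ∀ (l : List Bool) (s : Store), s v = l →
      Run (Cmd.moveRev₂ v w z) s
        (Function.update (Function.update (Function.update s w (l.reverse ++ s w))
          z (l.reverse ++ s z)) v [])
        (5 * l.length + 1) from H _ s rfl
  intro l
  induction l with
  | nil =>
    intro s hs
    simp only [List.reverse_nil, List.nil_append, Function.update_eq_self]
    rw [← hs, Function.update_eq_self, hs]
    exact Run.loop_done hs
  | cons b l ih =>
    intro s hs
    have h1 := Run.seq (Run.push w b s) (Run.seq (Run.push z b _) (Run.pop v _))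
    rw [Function.update_of_ne hvz, Function.update_of_ne hvw, hs, List.tail_cons,
      Function.update_of_ne hwz.symm] at h1
    have h2 := ih _ (show (Function.update (Function.update (Function.update s w (b :: s w))
      z (b :: s z)) v l) v = l by simp)
    have h1' : Run (.branch v .skip
        (.seq (.push w false) (.seq (.push z false) (.pop v)))
        (.seq (.push w true) (.seq (.push z true) (.pop v)))) s
        (Function.update (Function.update (Function.update s w (b :: s w))
          z (b :: s z)) v l) 4 := by
      cases b
      · exact Run.branch_false (by simp [hs]) h1
      · exact Run.branch_true (by simp [hs]) h1
    have h3 := Run.loop_step (by simp [hs]) h1' h2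
    refine h3.cast ?_ ?_
    · funext u
      simp only [Function.update_apply]
      have := hvw.symm
      have := hvz.symm
      have := hwz.symm
      by_cases h1 : u = v <;> by_cases h2 : u = w <;> by_cases h3 : u = z <;> simp_all
    · simp only [List.length_cons]; ring

/-- Copy stack `v` to the empty stack `w`, with the help of the empty stack `z`. -/
def Cmd.copy (z v w : ℕ) : Cmd := .seq (.moveRev v z) (.moveRev₂ z v w)

theorem Run.copy {z v w : ℕ} (hzv : z ≠ v) (hzw : z ≠ w) (hvw : v ≠ w) (s : Store)
    (hz : s z = []) (hw : s w = []) :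
    Run (Cmd.copy z v w) s (Function.update s w (s v)) (9 * (s v).length + 2) := by
  have h := Run.seq (Run.moveRev hzv.symm s) (Run.moveRev₂ hzv hzw hvw _)
  have e : (Function.update (Function.update s z ((s v).reverse ++ s z)) v []) z
      = (s v).reverse := by
    rw [Function.update_of_ne hzv]; simp [hz]
  rw [e] at h
  refine h.cast ?_ ?_
  · funext u
    simp only [Function.update_apply]
    by_cases h1 : u = v <;> by_cases h2 : u = w <;> by_cases h3 : u = z <;> simp_all
  · simp; ring

/-- Copy the stacks `src i` to the stacks `dst i`, for `i < k`. -/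
def Cmd.copyAll (z : ℕ) (src dst : ℕ → ℕ) : ℕ → Cmd
  | 0 => .skip
  | k + 1 => .seq (Cmd.copyAll z src dst k) (.copy z (src k) (dst k))

theorem Run.copyAll (z : ℕ) (src dst : ℕ → ℕ) (k N : ℕ) (s : Store) (hz : s z = [])
    (hzs : ∀ i < k, z ≠ src i) (hzd : ∀ i < k, z ≠ dst i)
    (hsd : ∀ i < k, ∀ j < k, src i ≠ dst j) (hdd : ∀ i < k, ∀ j < k, dst i = dst j → i = j)
    (hd : ∀ i < k, s (dst i) = []) (hN : ∀ i < k, (s (src i)).length ≤ N) :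
    ∃ τ ≤ k * (9 * N + 2) + 1, ∃ s' : Store, Run (Cmd.copyAll z src dst k) s s' τ ∧
      (∀ i < k, s' (dst i) = s (src i)) ∧ (∀ v, (∀ i < k, v ≠ dst i) → s' v = s v) := by
  induction k with
  | zero => exact ⟨1, by omega, s, Run.skip s, by simp, fun _ _ => rfl⟩
  | succ k ih =>
    obtain ⟨τ, hτ, s', h, h1, h2⟩ := ih (fun i hi => hzs i (by omega)) (fun i hi => hzd i (by omega))
      (fun i hi j hj => hsd i (by omega) j (by omega))
      (fun i hi j hj => hdd i (by omega) j (by omega)) (fun i hi => hd i (by omega))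
      (fun i hi => hN i (by omega))
    have e1 : s' z = [] := by rw [h2 z fun i hi => hzd i (by omega), hz]
    have e2 : s' (dst k) = [] := by
      rw [h2 _ ?_, hd k (by omega)]
      intro i hi e
      have := hdd k (by omega) i (by omega) e
      omega
    have e3 : s' (src k) = s (src k) := h2 _ fun i hi => hsd k (by omega) i (by omega)
    have h3 := Run.seq h (Run.copy (hzs k (by omega)) (hzd k (by omega))
      (hsd k (by omega) k (by omega)) s' e1 e2)
    rw [e3] at h3
    refine ⟨_, ?_, _, h3, ?_, ?_⟩
    · have := hN k (by omega)
      nlinarith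
    · intro i hi
      by_cases hik : i = k
      · subst hik; simp
      · rw [Function.update_of_ne, h1 i (by omega)]
        intro e
        exact hik (hdd i (by omega) k (by omega) e)
    · intro v hv
      rw [Function.update_of_ne (hv k (by omega)), h2 v fun i hi => hv i (by omega)]

/-! ## Subroutines: evaluating polynomial-time functions on saved registers -/

theorem length_getD_le_inputSize (xs : List (List Bool)) (i : ℕ) :
    (xs.getD i []).length ≤ inputSize xs := by
  induction xs generalizing i with
  | nil => simp
  | cons x xs ih =>
    cases i with
    | zero => simp [inputSize]
    | succ i =>
      have := ih i
      simp only [inputSize, List.map_cons, List.sum_cons, List.getD_cons_succ] at this ⊢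
      omega

theorem PolyTimeOn.length_le {α : Type} {D : Set α} {inp : α → List (List Bool)}
    {f : α → List Bool} (h : PolyTimeOn D inp f) :
    ∃ p : Polynomial ℕ, ∀ a ∈ D, (f a).length ≤ p.eval (inputSize (inp a)) := by
  obtain ⟨c, p, h⟩ := h
  refine ⟨Polynomial.X + p, fun a ha => ?_⟩
  obtain ⟨s, τ, hr, h0, hτ⟩ := h a ha
  have := hr.length_le 0
  rw [h0] at this
  have := length_getD_le_inputSize (inp a) 0
  simp only [Polynomial.eval_add, Polynomial.eval_X]
  simp only [initStore] at *
  omega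

theorem Polynomial.eval_mono_nat (p : Polynomial ℕ) {a b : ℕ} (h : a ≤ b) :
    p.eval a ≤ p.eval b := by
  simp only [Polynomial.eval_eq_sum_range]
  gcongr

/-- The stacks `src i` hold the inputs `xs`, and the scratch stacks are empty. -/
structure Store.Holds (s : Store) (K z k : ℕ) (src : ℕ → ℕ) (xs : List (List Bool)) : Prop where
  low : ∀ v < K, s v = []
  tmp : s z = []
  src : ∀ i < k, s (src i) = xs.getD i []

/-- The calling convention for subroutines: saved inputs lie on stacks from `K` on, the stacks below
`K` are an empty workspace. The inputs are copied down, the program is run there by `Run.frame`, its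
output is moved up to `dst`, and the workspace is cleared, so that the only net effect is on `dst`.
-/
theorem PolyTimeOn.evalInto {α : Type} {D : Set α} {inp : α → List (List Bool)}
    {f : α → List Bool} (h : PolyTimeOn D inp f) {k : ℕ} (hk : ∀ a ∈ D, (inp a).length = k) :
    ∃ K₀, ∀ K ≥ K₀, ∀ (src : ℕ → ℕ) (dst z : ℕ), (∀ i < k, K ≤ src i) → (∀ i < k, src i ≠ z) →
      K ≤ dst → K ≤ z → dst ≠ z →
      ∃ (c : Cmd) (q : Polynomial ℕ), ∀ a ∈ D, ∀ s : Store, s.Holds K z k src (inp a) →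
        s dst = [] →
        ∃ τ ≤ q.eval (inputSize (inp a)), Run c s (Function.update s dst (f a)) τ := by
  obtain ⟨c, p, h⟩ := h
  -- The workspace must contain all stacks used by `c` and the `k` input stacks; the `+ 1` puts the
  -- output stack `0` there even if `k = 0`.
  refine ⟨max c.bound (k + 1), fun K hK src dst z hsK hsz hdK hzK hdz => ?_⟩
  have hcK : c.bound ≤ K := le_trans (le_max_left _ _) hK
  have hkK : k < K := le_trans (le_max_right _ _) hK
  refine ⟨.seq (.copyAll z src id k) (.seq c (.seq (.moveRev 0 z) (.seq (.moveRev z dst)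
    (.clearRange 0 K)))), Polynomial.C k * (9 * Polynomial.X + 2) + 1 + p +
      8 * (Polynomial.X + p) + 2 + Polynomial.C K * (2 * (Polynomial.X + p) + 1) + 1,
      fun a ha s hs hd => ?_⟩
  obtain ⟨s2, τ2, hr, h0, hτ2⟩ := h a ha
  set N := inputSize (inp a)
  obtain ⟨τ1, hτ1, s1, hr1, h1, h1'⟩ := Run.copyAll z src id k N s hs.tmp
    (fun i hi => (hsz i hi).symm) (fun i hi => by simp only [id]; omega)
    (fun i hi j hj => by have := hsK i hi; have : id j = j := rfl; omega)
    (fun i _ j _ e => e) (fun i hi => hs.low i (by omega))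
    (fun i hi => by rw [hs.src i hi]; exact length_getD_le_inputSize _ _)
  have e1 : ∀ v < K, s1 v = initStore (inp a) v := by
    intro v hv
    by_cases hvk : v < k
    · exact (h1 v hvk).trans (hs.src v hvk)
    · rw [h1' v (fun i hi => by simp only [id]; omega), hs.low v hv, initStore,
        List.getD_eq_default _ _ (by rw [hk a ha]; omega)]
  have e1' : ∀ v, K ≤ v → s1 v = s v := fun v hv => h1' v fun i hi => by simp only [id]; omega
  have hr2 := hr.frame K hcK s1 e1
  set s3 := Store.merge K s2 s1 with hs3
  have e30 : s3 0 = f a := by rw [hs3, Store.merge_apply, if_pos (by omega), h0]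
  have e3 : ∀ v, K ≤ v → s3 v = s v := by
    intro v hv
    rw [hs3, Store.merge_apply, if_neg (by omega), e1' v hv]
  -- The output travels through `z`, so that the two reversals cancel.
  have hr3 := Run.moveRev (v := 0) (w := z) (by omega) s3
  rw [e30, e3 z hzK, hs.tmp, List.append_nil] at hr3
  have hr4 := Run.moveRev (v := z) (w := dst) hdz.symm
    (Function.update (Function.update s3 z (f a).reverse) 0 [])
  have e5 : Function.update (Function.update s3 z (f a).reverse) 0 [] z = (f a).reverse := by
    rw [Function.update_of_ne (by omega)]; simp
  have e6 : Function.update (Function.update s3 z (f a).reverse) 0 [] dst = [] := by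
    rw [Function.update_of_ne (by omega), Function.update_of_ne hdz, e3 dst hdK, hd]
  rw [e5, e6, List.append_nil, List.reverse_reverse] at hr4
  set s5 := Function.update (Function.update
    (Function.update (Function.update s3 z (f a).reverse) 0 []) dst (f a)) z [] with hs5
  have hlen : ∀ v, (s2 v).length ≤ N + p.eval N := fun v => by
    have := hr.length_le v
    have := length_getD_le_inputSize (inp a) v
    simp only [initStore] at *
    omega
  obtain ⟨τ5, hτ5, hr5⟩ := Run.clearRange 0 K (N + p.eval N) s5 (by
    intro i hi
    rw [zero_add, hs5, Function.update_of_ne (by omega), Function.update_of_ne (by omega)]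
    by_cases hi0 : i = 0
    · subst hi0; simp
    · rw [Function.update_of_ne hi0, Function.update_of_ne (by omega), hs3, Store.merge_apply,
        if_pos hi]
      exact hlen i)
  have hfa : (f a).length ≤ N + p.eval N := h0 ▸ hlen 0
  refine ⟨_, ?_, (Run.seq hr1 (Run.seq hr2 (Run.seq hr3 (Run.seq hr4 hr5)))).cast ?_ rfl⟩
  · simp only [Polynomial.eval_add, Polynomial.eval_mul, Polynomial.eval_C, Polynomial.eval_X,
      Polynomial.eval_ofNat, Polynomial.eval_one, List.length_reverse]
    linarith
  · funext v
    by_cases hv : v < K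
    · rw [if_pos ⟨by omega, by omega⟩, Function.update_of_ne (by omega), hs.low v hv]
    · rw [if_neg (by omega), hs5]
      by_cases hvz : v = z
      · subst hvz; rw [Function.update_self, Function.update_of_ne hdz.symm, hs.tmp]
      · rw [Function.update_of_ne hvz]
        by_cases hvd : v = dst
        · subst hvd; simp
        · rw [Function.update_of_ne hvd, Function.update_of_ne hvd, Function.update_of_ne (by omega),
            Function.update_of_ne hvz, e3 v (by omega)]

/-- Evaluate several functions, storing the results on consecutive stacks. -/
theorem PolyTimeOn.evalMany {α : Type} {D : Set α} {inp : α → List (List Bool)}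
    {f : ℕ → α → List Bool} {l : ℕ} (h : ∀ j < l, PolyTimeOn D inp (f j)) {k : ℕ}
    (hk : ∀ a ∈ D, (inp a).length = k) :
    ∃ K₀, ∀ K ≥ K₀, ∀ (src : ℕ → ℕ) (dst z : ℕ), (∀ i < k, K ≤ src i) → (∀ i < k, src i ≠ z) →
      K ≤ dst → K ≤ z → (z < dst ∨ dst + l ≤ z) →
      (∀ i < k, src i < dst ∨ dst + l ≤ src i) →
      ∃ (c : Cmd) (q : Polynomial ℕ), ∀ a ∈ D, ∀ s : Store, s.Holds K z k src (inp a) →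
        (∀ j < l, s (dst + j) = []) →
        ∃ τ ≤ q.eval (inputSize (inp a)), ∃ s' : Store, Run c s s' τ ∧
          (∀ j < l, s' (dst + j) = f j a) ∧ (∀ v, v < dst ∨ dst + l ≤ v → s' v = s v) := by
  induction l with
  | zero =>
    exact ⟨0, fun K hK src dst z _ _ _ _ _ _ => ⟨.skip, 1, fun a ha s hs hd => ⟨1, by simp, s,
      Run.skip s, by simp, fun _ _ => rfl⟩⟩⟩
  | succ l ih =>
    obtain ⟨K₁, h1⟩ := ih fun j hj => h j (by omega)
    obtain ⟨K₂, h2⟩ := (h l (by omega)).evalInto hk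
    refine ⟨max K₁ K₂, fun K hK src dst z hsK hsz hdK hzK hdz hds => ?_⟩
    obtain ⟨c1, q1, h1⟩ := h1 K (le_trans (le_max_left _ _) hK) src dst z hsK hsz hdK hzK
      (by omega) (fun i hi => by have := hds i hi; omega)
    obtain ⟨c2, q2, h2⟩ := h2 K (le_trans (le_max_right _ _) hK) src (dst + l) z hsK hsz
      (by omega) hzK (by omega)
    refine ⟨.seq c1 c2, q1 + q2, fun a ha s hs hd => ?_⟩
    obtain ⟨τ1, hτ1, s1, hr1, h11, h12⟩ := h1 a ha s hs fun j hj => hd j (by omega)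
    obtain ⟨τ2, hτ2, hr2⟩ := h2 a ha s1
      ⟨fun v hv => by rw [h12 v (by omega), hs.low v hv],
        by rw [h12 z (by omega), hs.tmp],
        fun i hi => by
          have := hds i hi
          rw [h12 _ (by omega), hs.src i hi]⟩
      (by rw [h12 _ (by omega), hd l (by omega)])
    refine ⟨τ1 + τ2, ?_, _, Run.seq hr1 hr2, fun j hj => ?_, fun v hv => ?_⟩
    · rw [Polynomial.eval_add]; omega
    · by_cases hjl : j = l
      · subst hjl; simp
      · rw [Function.update_of_ne (by omega), h11 j (by omega)]
    · rw [Function.update_of_ne (by omega), h12 v (by omega)]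

/-- Save the inputs on stacks above `K`. -/
theorem Run.saveInputs (k K z : ℕ) (hkK : k ≤ K) (hz : K + k ≤ z) :
    ∃ (c : Cmd) (q : Polynomial ℕ), ∀ xs : List (List Bool), xs.length = k →
      ∃ τ ≤ q.eval (inputSize xs), ∃ s' : Store, Run c (initStore xs) s' τ ∧
        (∀ i < k, s' (K + i) = xs.getD i []) ∧ (∀ v, v < K ∨ K + k ≤ v → s' v = []) := by
  refine ⟨.seq (.copyAll z id (K + ·) k) (.clearRange 0 K), Polynomial.C k *
    (9 * Polynomial.X + 2) + 1 + Polynomial.C K * (2 * Polynomial.X + 1) + 1, fun xs hxs => ?_⟩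
  have hge : ∀ v, k ≤ v → initStore xs v = [] := fun v hv =>
    List.getD_eq_default _ _ (by omega)
  obtain ⟨τ1, hτ1, s1, hr1, h1, h1'⟩ := Run.copyAll z id (K + ·) k (inputSize xs) (initStore xs)
    (hge z (by omega)) (fun i hi => by simp only [id]; omega) (fun i hi => by omega)
    (fun i hi j hj => by simp only [id]; omega) (fun i _ j _ e => by omega)
    (fun i hi => hge _ (by omega)) (fun i hi => length_getD_le_inputSize _ _)
  obtain ⟨τ2, hτ2, hr2⟩ := Run.clearRange 0 K (inputSize xs) s1 (fun i hi => by
    rw [h1' _ (fun j hj => by omega)]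
    exact length_getD_le_inputSize _ _)
  refine ⟨_, ?_, _, Run.seq hr1 hr2, fun i hi => ?_, fun v hv => ?_⟩
  · simp only [Polynomial.eval_add, Polynomial.eval_mul, Polynomial.eval_C, Polynomial.eval_X,
      Polynomial.eval_ofNat, Polynomial.eval_one]
    linarith
  · rw [if_neg (by omega)]
    exact h1 i hi
  · by_cases hv : v < K
    · rw [if_pos ⟨by omega, by omega⟩]
    · rw [if_neg (by omega), h1' v (fun i hi => by omega), hge v (by omega)]

/-! ### Composition and bounded iteration -/

theorem inputSize_map_range (l : ℕ) (g : ℕ → List Bool) :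
    inputSize ((List.range l).map g) = ∑ j ∈ Finset.range l, (g j).length := by
  induction l with
  | zero => simp [inputSize]
  | succ l ih =>
    rw [Finset.sum_range_succ, ← ih, List.range_succ]
    simp [inputSize]

theorem inputSize_append (xs ys : List (List Bool)) :
    inputSize (xs ++ ys) = inputSize xs + inputSize ys := by
  simp [inputSize]

/-- Composition of polynomial-time functions. -/
theorem PolyTimeOn.comp {α β : Type} {D : Set α} {inp : α → List (List Bool)} {k : ℕ}
    (hk : ∀ a ∈ D, (inp a).length = k) {f : ℕ → α → List Bool} {l : ℕ}
    (hf : ∀ j < l, PolyTimeOn D inp (f j))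
    {D' : Set β} {inp' : β → List (List Bool)} {g : β → List Bool} (hg : PolyTimeOn D' inp' g)
    (φ : α → β) (hφ : ∀ a ∈ D, φ a ∈ D')
    (hinp : ∀ a ∈ D, inp' (φ a) = (List.range l).map fun j => f j a) :
    PolyTimeOn D inp (fun a => g (φ a)) := by
  obtain ⟨K₁, h1⟩ := PolyTimeOn.evalMany hf hk
  -- `evalInto` needs a constant number of inputs, which is known for `g` only on the image of `D`.
  have hg' : PolyTimeOn (φ '' D) inp' g := by
    obtain ⟨c, p, h⟩ := hg
    exact ⟨c, p, by rintro _ ⟨a, ha, rfl⟩; exact h _ (hφ a ha)⟩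
  obtain ⟨K₂, h2⟩ := hg'.evalInto (k := l)
    (by rintro _ ⟨a, ha, rfl⟩; rw [hinp a ha]; simp)
  choose! P hP using fun j hj => (hf j hj).length_le
  obtain ⟨K, hK1, hK2, hKk⟩ : ∃ K, K₁ ≤ K ∧ K₂ ≤ K ∧ k + 1 ≤ K :=
    ⟨max (max K₁ K₂) (k + 1), by omega, by omega, by omega⟩
  obtain ⟨c0, q0, h0⟩ := Run.saveInputs k K (K + k + l) (by omega) (by omega)
  obtain ⟨c1, q1, h1⟩ := h1 K hK1 (K + ·) (K + k) (K + k + l) (by omega) (by omega) (by omega)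
    (by omega) (by omega) (by omega)
  obtain ⟨c2, q2, h2⟩ := h2 K hK2 (K + k + ·) (K + k + l + 1) (K + k + l) (by omega) (by omega)
    (by omega) (by omega) (by omega)
  obtain ⟨r, hr⟩ := hg'.length_le
  have hsize : ∀ a ∈ D, inputSize (inp' (φ a)) ≤
      (∑ j ∈ Finset.range l, P j).eval (inputSize (inp a)) := by
    intro a ha
    rw [hinp a ha, inputSize_map_range, Polynomial.eval_finsetSum]
    exact Finset.sum_le_sum fun j hj => hP j (Finset.mem_range.1 hj) a ha
  refine ⟨.seq c0 (.seq c1 (.seq c2 (.copy (K + k + l) (K + k + l + 1) 0))),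
    q0 + q1 + q2.comp (∑ j ∈ Finset.range l, P j) +
      9 * r.comp (∑ j ∈ Finset.range l, P j) + 2, fun a ha => ?_⟩
  obtain ⟨τ0, hτ0, s0, hr0, h01, h02⟩ := h0 (inp a) (hk a ha)
  obtain ⟨τ1, hτ1, s1, hr1, h11, h12⟩ := h1 a ha s0 ⟨fun v hv => h02 v (by omega),
    h02 _ (by omega), h01⟩ (fun j hj => h02 _ (by omega))
  obtain ⟨τ2, hτ2, hr2⟩ := h2 (φ a) ⟨a, ha, rfl⟩ s1 ⟨fun v hv => by
    rw [h12 v (by omega), h02 v (by omega)], by rw [h12 _ (by omega), h02 _ (by omega)],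
    fun i hi => by
      rw [h11 i hi, hinp a ha]
      simp [hi]⟩ (by rw [h12 _ (by omega), h02 _ (by omega)])
  have hr3 := Run.copy (z := K + k + l) (v := K + k + l + 1) (w := 0) (by omega) (by omega)
    (by omega) (Function.update s1 (K + k + l + 1) (g (φ a))) (by
      rw [Function.update_of_ne (by omega), h12 _ (by omega), h02 _ (by omega)]) (by
      rw [Function.update_of_ne (by omega), h12 _ (by omega), h02 _ (by omega)])
  refine ⟨_, _, Run.seq hr0 (Run.seq hr1 (Run.seq hr2 hr3)), by simp, ?_⟩
  rw [Function.update_self]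
  have e1 := hr (φ a) ⟨a, ha, rfl⟩
  have e2 := q2.eval_mono_nat (hsize a ha)
  have e3 := r.eval_mono_nat (hsize a ha)
  simp only [Polynomial.eval_add, Polynomial.eval_mul, Polynomial.eval_ofNat, Polynomial.eval_comp]
  omega

/-- A counting loop with polynomially bounded state. -/
theorem PolyTimeOn.iterate {α : Type} {D : Set α} {inp : α → List (List Bool)} {k : ℕ}
    (hk : ∀ a ∈ D, (inp a).length = k) {l : ℕ} (σ : α → ℕ → ℕ → List Bool)
    {cnt : α → List Bool} (hcnt : PolyTimeOn D inp cnt)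
    (hinit : ∀ j < l, PolyTimeOn D inp (fun a => σ a 0 j))
    (hstep : ∀ j < l, PolyTimeOn {p : α × ℕ | p.1 ∈ D ∧ p.2 < (cnt p.1).length}
      (fun p => inp p.1 ++ (List.range l).map (σ p.1 p.2)) (fun p => σ p.1 (p.2 + 1) j))
    (b : Polynomial ℕ)
    (hb : ∀ a ∈ D, ∀ i ≤ (cnt a).length, ∀ j < l, (σ a i j).length ≤ b.eval (inputSize (inp a)))
    {j : ℕ} (hj : j < l) : PolyTimeOn D inp (fun a => σ a (cnt a).length j) := by
  obtain ⟨K₁, h1⟩ := hcnt.evalInto hk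
  obtain ⟨K₂, h2⟩ := PolyTimeOn.evalMany hinit hk
  obtain ⟨K₃, h3⟩ := PolyTimeOn.evalMany hstep (k := k + l) (by
    rintro ⟨a, i⟩ ⟨ha, hi⟩
    simp [hk a ha])
  obtain ⟨r, hr⟩ := hcnt.length_le
  obtain ⟨K, hK1, hK2, hK3, hKk⟩ : ∃ K, K₁ ≤ K ∧ K₂ ≤ K ∧ K₃ ≤ K ∧ k + 1 ≤ K :=
    ⟨max (max K₁ K₂) (max K₃ (k + 1)), by omega, by omega, by omega, by omega⟩
  -- layout: inputs, state, next state, counter, scratch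
  obtain ⟨c0, q0, h0⟩ := Run.saveInputs k K (K + k + 2 * l + 1) (by omega) (by omega)
  obtain ⟨c1, q1, h1⟩ := h1 K hK1 (K + ·) (K + k + 2 * l) (K + k + 2 * l + 1) (by omega) (by omega)
    (by omega) (by omega) (by omega)
  obtain ⟨c2, q2, h2⟩ := h2 K hK2 (K + ·) (K + k) (K + k + 2 * l + 1) (by omega) (by omega)
    (by omega) (by omega) (by omega) (by omega)
  obtain ⟨c3, q3, h3⟩ := h3 K hK3 (K + ·) (K + k + l) (K + k + 2 * l + 1) (by omega) (by omega)
    (by omega) (by omega) (by omega) (by omega)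
  set z := K + k + 2 * l + 1 with hz
  -- A bound for the total size of the inputs and the current state, that is, for the input of one
  -- evaluation of the step functions.
  set B : Polynomial ℕ := Polynomial.X + Polynomial.C l * b with hB
  -- The next state gets its own block, since each of its components may depend on the whole old
  -- state. Only after all are computed is the old block cleared and overwritten.
  set body : Cmd := .seq (.pop (K + k + 2 * l)) (.seq c3 (.seq (.clearRange (K + k) l)
    (.seq (.copyAll z (K + k + l + ·) (K + k + ·) l) (.clearRange (K + k + l) l)))) with hbody
  set q4 : Polynomial ℕ := 1 + q3.comp B + (Polynomial.C l * (2 * b + 1) + 1) +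
    (Polynomial.C l * (9 * b + 2) + 1) + (Polynomial.C l * (2 * b + 1) + 1) with hq4
  have hsize : ∀ a ∈ D, ∀ i ≤ (cnt a).length,
      inputSize (inp a ++ (List.range l).map (σ a i)) ≤ B.eval (inputSize (inp a)) := by
    intro a ha i hi
    rw [inputSize_append, inputSize_map_range, hB]
    simp only [Polynomial.eval_add, Polynomial.eval_X, Polynomial.eval_mul, Polynomial.eval_C]
    have := Finset.sum_le_card_nsmul (Finset.range l) (fun j => (σ a i j).length)
      (b.eval (inputSize (inp a))) (fun j hj => hb a ha i hi j (Finset.mem_range.1 hj))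
    simpa using this
  -- the invariant
  let Inv : α → ℕ → Store → Prop := fun a i s =>
    (∀ v < K, s v = []) ∧ s z = [] ∧ (∀ j < k, s (K + j) = (inp a).getD j []) ∧
    (∀ j < l, s (K + k + j) = σ a i j) ∧ (∀ j < l, s (K + k + l + j) = []) ∧
    s (K + k + 2 * l) = (cnt a).drop i
  have hbodyRun : ∀ a ∈ D, ∀ i < (cnt a).length, ∀ s, Inv a i s →
      ∃ τ ≤ q4.eval (inputSize (inp a)), ∃ s', Run body s s' τ ∧ Inv a (i + 1) s' := by
    rintro a ha i hi s ⟨i1, i2, i3, i4, i5, i6⟩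
    have r1 := Run.pop (K + k + 2 * l) s
    set s1 := Function.update s (K + k + 2 * l) (s (K + k + 2 * l)).tail with hs1
    have e1 : ∀ v, v ≠ K + k + 2 * l → s1 v = s v := fun v hv => Function.update_of_ne hv _ _
    have e1' : s1 (K + k + 2 * l) = (cnt a).drop (i + 1) := by
      rw [hs1, Function.update_self, i6, List.tail_drop]
    obtain ⟨τ2, hτ2, s2, r2, h21, h22⟩ := h3 (a, i) ⟨ha, hi⟩ s1
      ⟨fun v hv => by rw [e1 v (by omega), i1 v hv], by rw [e1 z (by omega), i2], fun j hj => by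
        simp only
        rw [e1 _ (by omega)]
        by_cases hjk : j < k
        · rw [i3 j hjk, List.getD_append _ _ _ _ (by rw [hk a ha]; exact hjk)]
        · rw [List.getD_append_right _ _ _ _ (by rw [hk a ha]; omega), hk a ha,
            show K + j = K + k + (j - k) by omega, i4 _ (by omega)]
          simp [show j - k < l by omega]⟩
      (fun j hj => by rw [e1 _ (by omega), i5 j hj])
    obtain ⟨τ3, hτ3, r3⟩ := Run.clearRange (K + k) l (b.eval (inputSize (inp a))) s2
      (fun j hj => by
        rw [h22 _ (by omega), e1 _ (by omega), i4 j hj]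
        exact hb a ha i hi.le j hj)
    obtain ⟨s3, hs3⟩ : ∃ s3 : Store, s3 = fun v => if K + k ≤ v ∧ v < K + k + l then [] else s2 v :=
      ⟨_, rfl⟩
    rw [← hs3] at r3
    have e3 : ∀ v, v < K + k ∨ K + k + l ≤ v → s3 v = s2 v := fun v hv => by
      rw [hs3]; exact if_neg (by omega)
    have e3' : ∀ j < l, s3 (K + k + j) = [] := fun j hj => by
      rw [hs3]; exact if_pos (by omega)
    obtain ⟨τ4, hτ4, s4, r4, h41, h42⟩ := Run.copyAll z (K + k + l + ·) (K + k + ·) l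
      (b.eval (inputSize (inp a))) s3 (by rw [e3 _ (by omega), h22 _ (by omega), e1 _ (by omega), i2])
      (by omega) (by omega) (by omega) (by omega) e3' (fun j hj => by
        rw [e3 _ (by omega), h21 j hj]
        exact hb a ha (i + 1) hi j hj)
    obtain ⟨τ5, hτ5, r5⟩ := Run.clearRange (K + k + l) l (b.eval (inputSize (inp a))) s4
      (fun j hj => by
        rw [h42 _ (by omega), e3 _ (by omega), h21 j hj]
        exact hb a ha (i + 1) hi j hj)
    have e4 : ∀ v, v < K + k ∨ K + k + 2 * l ≤ v → s4 v = s1 v := fun v hv => by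
      rw [h42 _ (by omega), e3 _ (by omega), h22 _ (by omega)]
    refine ⟨_, ?_, _, Run.seq r1 (Run.seq r2 (Run.seq r3 (Run.seq r4 r5))), ?_, ?_, ?_, ?_, ?_, ?_⟩
    · have := q3.eval_mono_nat (hsize a ha i hi.le)
      simp only [hq4, Polynomial.eval_add, Polynomial.eval_mul, Polynomial.eval_C,
        Polynomial.eval_ofNat, Polynomial.eval_one, Polynomial.eval_comp] at *
      omega
    · intro v hv
      dsimp only
      rw [if_neg (by omega), e4 _ (by omega), e1 _ (by omega), i1 v hv]
    · dsimp only
      rw [if_neg (by omega), e4 _ (by omega), e1 _ (by omega), i2]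
    · intro j hj
      dsimp only
      rw [if_neg (by omega), e4 _ (by omega), e1 _ (by omega), i3 j hj]
    · intro j hj
      dsimp only
      rw [if_neg (by omega), h41 j hj, e3 _ (by omega), h21 j hj]
    · intro j hj
      dsimp only
      rw [if_pos (by omega)]
    · dsimp only
      rw [if_neg (by omega), e4 _ (by omega), e1']
  have hloop : ∀ a ∈ D, ∀ n i, i + n = (cnt a).length → ∀ s, Inv a i s →
      ∃ τ ≤ n * (q4.eval (inputSize (inp a)) + 1) + 1, ∃ s',
        Run (.loop (K + k + 2 * l) body) s s' τ ∧ Inv a (cnt a).length s' := by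
    intro a ha n
    induction n with
    | zero =>
      intro i hi s hs
      refine ⟨1, by omega, s, Run.loop_done ?_, by rwa [show (cnt a).length = i by omega]⟩
      rw [hs.2.2.2.2.2, List.drop_eq_nil_of_le (by omega)]
    | succ n ih =>
      intro i hi s hs
      obtain ⟨τ1, hτ1, s1, r1, hs1⟩ := hbodyRun a ha i (by omega) s hs
      obtain ⟨τ2, hτ2, s2, r2, hs2⟩ := ih (i + 1) (by omega) s1 hs1
      refine ⟨_, ?_, s2, Run.loop_step ?_ r1 r2, hs2⟩
      · linarith
      · rw [hs.2.2.2.2.2]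
        intro h
        rw [List.drop_eq_nil_iff] at h
        omega
  refine ⟨.seq c0 (.seq c1 (.seq c2 (.seq (.loop (K + k + 2 * l) body)
    (.copy z (K + k + j) 0)))), q0 + q1 + q2 + (r * (q4 + 1) + 1) + (9 * b + 2), fun a ha => ?_⟩
  obtain ⟨τ0, hτ0, s0, r0, h01, h02⟩ := h0 (inp a) (hk a ha)
  obtain ⟨τ1, hτ1, r1⟩ := h1 a ha s0 ⟨fun v hv => h02 v (by omega), h02 _ (by omega), h01⟩
    (h02 _ (by omega))
  obtain ⟨τ2, hτ2, s2, r2, h21, h22⟩ := h2 a ha (Function.update s0 (K + k + 2 * l) (cnt a))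
    ⟨fun v hv => by rw [Function.update_of_ne (by omega), h02 v (by omega)],
      by rw [Function.update_of_ne (by omega), h02 _ (by omega)],
      fun i hi => by rw [Function.update_of_ne (by omega), h01 i hi]⟩
    (fun i hi => by rw [Function.update_of_ne (by omega), h02 _ (by omega)])
  have h23 : ∀ v, v < K + k ∨ K + k + l ≤ v → v ≠ K + k + 2 * l → s2 v = s0 v := fun v hv hv' => by
    rw [h22 v hv, Function.update_of_ne hv']
  obtain ⟨τ3, hτ3, s3, r3, i1, i2, i3, i4, i5, i6⟩ := hloop a ha (cnt a).length 0 (by omega) s2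
    ⟨fun v hv => by rw [h23 v (by omega) (by omega), h02 v (by omega)],
      by rw [h23 z (by omega) (by omega), h02 z (by omega)],
      fun j hj => by rw [h23 _ (by omega) (by omega), h01 j hj], h21,
      fun j hj => by rw [h23 _ (by omega) (by omega), h02 _ (by omega)],
      by rw [h22 _ (by omega), Function.update_self, List.drop_zero]⟩
  have r4 := Run.copy (z := z) (v := K + k + j) (w := 0) (by omega) (by omega) (by omega) s3 i2
    (i1 0 (by omega))
  refine ⟨_, _, Run.seq r0 (Run.seq r1 (Run.seq r2 (Run.seq r3 r4))), ?_, ?_⟩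
  · rw [Function.update_self, i4 j hj]
  · rw [i4 j hj]
    have e1 := hb a ha _ le_rfl j hj
    have e2 := Nat.mul_le_mul_right (q4.eval (inputSize (inp a)) + 1) (hr a ha)
    simp only [Polynomial.eval_add, Polynomial.eval_mul, Polynomial.eval_ofNat,
      Polynomial.eval_one]
    omega

/-! ## Closure properties of polynomial-time functions -/

/-- `f` is computable in polynomial time from the fixed number of inputs `inp`. -/
def PolyFun {α : Type} (D : Set α) (inp : α → List (List Bool)) (f : α → List Bool) : Prop :=
  (∃ k, ∀ a ∈ D, (inp a).length = k) ∧ PolyTimeOn D inp f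

/-- `g` is bounded by a polynomial in the number of input bits. -/
def PolyBdd {α : Type} (D : Set α) (inp : α → List (List Bool)) (g : α → ℕ) : Prop :=
  ∃ b : Polynomial ℕ, ∀ a ∈ D, g a ≤ b.eval (inputSize (inp a))

section
variable {α : Type} {D : Set α} {inp : α → List (List Bool)} {f g h : α → List Bool}

theorem PolyBdd.const (n : ℕ) : PolyBdd D inp (fun _ => n) :=
  ⟨Polynomial.C n, fun a _ => by simp⟩

theorem PolyBdd.add {u v : α → ℕ} (hu : PolyBdd D inp u) (hv : PolyBdd D inp v) :
    PolyBdd D inp (fun a => u a + v a) := by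
  obtain ⟨b, hb⟩ := hu
  obtain ⟨c, hc⟩ := hv
  exact ⟨b + c, fun a ha => by rw [Polynomial.eval_add]; exact add_le_add (hb a ha) (hc a ha)⟩

theorem PolyBdd.mul {u v : α → ℕ} (hu : PolyBdd D inp u) (hv : PolyBdd D inp v) :
    PolyBdd D inp (fun a => u a * v a) := by
  obtain ⟨b, hb⟩ := hu
  obtain ⟨c, hc⟩ := hv
  exact ⟨b * c, fun a ha => by rw [Polynomial.eval_mul]; exact Nat.mul_le_mul (hb a ha) (hc a ha)⟩

theorem PolyFun.bdd (hf : PolyFun D inp f) : PolyBdd D inp (fun a => (f a).length) :=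
  hf.2.length_le

theorem PolyFun.congr (hf : PolyFun D inp f) (h : ∀ a ∈ D, g a = f a) : PolyFun D inp g := by
  obtain ⟨hk, c, p, hc⟩ := hf
  exact ⟨hk, c, p, fun a ha => by rw [h a ha]; exact hc a ha⟩

theorem PolyFun.input (hk : ∃ k, ∀ a ∈ D, (inp a).length = k) (j : ℕ) :
    PolyFun D inp (fun a => (inp a).getD j []) := by
  refine ⟨hk, ?_⟩
  obtain ⟨k, hk⟩ := hk
  -- With `k + 1` instead of `k`, stack `0` is always among the cleared ones: it can receive the
  -- copy, and it already holds the default value `[]` if `j` is out of range.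
  obtain ⟨c, q, hc⟩ := Run.saveInputs k (k + 1) (2 * k + 1) (by omega) (by omega)
  by_cases hj : j < k
  · refine ⟨.seq c (.copy (2 * k + 1) (k + 1 + j) 0), q + 9 * Polynomial.X + 2, fun a ha => ?_⟩
    obtain ⟨τ, hτ, s, hr, h1, h2⟩ := hc (inp a) (hk a ha)
    refine ⟨_, _, Run.seq hr (Run.copy (by omega) (by omega) (by omega) s (h2 _ (by omega))
      (h2 _ (by omega))), by rw [Function.update_self, h1 j hj], ?_⟩
    rw [h1 j hj]
    have := length_getD_le_inputSize (inp a) j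
    simp only [Polynomial.eval_add, Polynomial.eval_mul, Polynomial.eval_ofNat, Polynomial.eval_X]
    omega
  · refine ⟨c, q, fun a ha => ?_⟩
    obtain ⟨τ, hτ, s, hr, h1, h2⟩ := hc (inp a) (hk a ha)
    exact ⟨s, τ, hr, by
      rw [h2 0 (by omega)]
      exact (List.getD_eq_default _ _ (by rw [hk a ha]; omega)).symm, hτ⟩

theorem PolyFun.comp {β : Type} {D' : Set β} {inp' : β → List (List Bool)} {G : β → List Bool}
    (hG : PolyTimeOn D' inp' G) (φ : α → β) (fs : List (α → List Bool))
    (hk : ∃ k, ∀ a ∈ D, (inp a).length = k)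
    (hfs : ∀ f ∈ fs, PolyFun D inp f) (hφ : ∀ a ∈ D, φ a ∈ D')
    (hinp : ∀ a ∈ D, inp' (φ a) = fs.map (· a)) : PolyFun D inp (fun a => G (φ a)) := by
  refine ⟨hk, ?_⟩
  obtain ⟨k, hk⟩ := hk
  refine PolyTimeOn.comp hk (f := fun j => fs.getD j fun _ => []) (l := fs.length)
    (fun j hj => ?_) hG φ hφ fun a ha => ?_
  · rw [List.getD_eq_getElem _ _ hj]
    exact (hfs _ (List.getElem_mem hj)).2
  · rw [hinp a ha]
    apply List.ext_getElem (by simp)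
    intro i h1 h2
    simp at h1
    simp [h1]

theorem PolyFun.comp₁ {G : List Bool → List Bool} (hG : PolyTimeFun G) (hf : PolyFun D inp f) :
    PolyFun D inp (fun a => G (f a)) :=
  PolyFun.comp hG f [f] hf.1 (by simpa using hf) (fun _ _ => Set.mem_univ _) fun _ _ => rfl

theorem PolyFun.nil (hk : ∃ k, ∀ a ∈ D, (inp a).length = k) : PolyFun D inp (fun _ => []) := by
  obtain ⟨k, hk'⟩ := hk
  exact (PolyFun.input ⟨k, hk'⟩ k).congr fun a ha => by
    rw [List.getD_eq_default _ _ (by rw [hk' a ha])]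

theorem PolyFun.cons (b : Bool) (hf : PolyFun D inp f) : PolyFun D inp (fun a => b :: f a) :=
  PolyFun.comp₁ (G := fun x => b :: x) ⟨.push 0 b, 1, fun x _ => ⟨_, _, Run.push 0 b _, by
    simp [initStore], by simp⟩⟩ hf

theorem PolyFun.tail (hf : PolyFun D inp f) : PolyFun D inp (fun a => (f a).tail) :=
  PolyFun.comp₁ (G := fun x => x.tail) ⟨.pop 0, 1, fun x _ => ⟨_, _, Run.pop 0 _, by
    simp [initStore], by simp⟩⟩ hf

theorem PolyFun.const (hf : ∃ k, ∀ a ∈ D, (inp a).length = k) (x : List Bool) :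
    PolyFun D inp (fun _ => x) := by
  induction x with
  | nil => exact PolyFun.nil hf
  | cons b x ih => exact ih.cons b

/-- Select one of three strings according to the first bit of a fourth one. -/
def List.sel (z e f t : List Bool) : List Bool :=
  match z with
  | [] => e
  | false :: _ => f
  | true :: _ => t

/-- All three alternatives are computed in advance, so branching reduces to one fixed program that
selects among four input stacks. Together with loops this replaces every other control structure
below. -/
theorem PolyFun.sel {z : α → List Bool} (hz : PolyFun D inp z) (hf : PolyFun D inp f)
    (hg : PolyFun D inp g) (hh : PolyFun D inp h) :
    PolyFun D inp (fun a => (z a).sel (f a) (g a) (h a)) := by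
  refine PolyFun.comp (D' := Set.univ)
    (inp' := fun p : List Bool × List Bool × List Bool × List Bool => [p.1, p.2.1, p.2.2.1, p.2.2.2])
    (G := fun p => p.1.sel p.2.1 p.2.2.1 p.2.2.2) ?_ (fun a => (z a, f a, g a, h a)) [z, f, g, h]
    hz.1 ?_ (fun _ _ => Set.mem_univ _) fun _ _ => rfl
  · refine ⟨.branch 0 (.copy 4 1 0) (.seq (.clear 0) (.copy 4 2 0)) (.seq (.clear 0) (.copy 4 3 0)),
      20 * Polynomial.X + 20, ?_⟩
    rintro ⟨z, e, f, t⟩ -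
    have key : ∀ v, v ≠ 0 → v < 4 → ∀ s : Store, s 0 = [] → s 4 = [] →
        Run (.copy 4 v 0) s (Function.update s 0 (s v)) (9 * (s v).length + 2) :=
      fun v h0 h4 s h1 h2 => Run.copy (by omega) (by omega) (by omega) s h2 h1
    set s := initStore [z, e, f, t] with hs
    have s0 : s 0 = z := rfl
    have s1 : s 1 = e := rfl
    have s2 : s 2 = f := rfl
    have s3 : s 3 = t := rfl
    have s4 : s 4 = [] := rfl
    have hev : ∀ n, Polynomial.eval n (20 * Polynomial.X + 20 : Polynomial ℕ) = 20 * n + 20 := by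
      intro n; simp
    simp only [hev]
    have hsz : inputSize [z, e, f, t] = z.length + (e.length + (f.length + t.length)) := by
      simp [inputSize]
    have hc := Run.clear 0 s
    match z, s0 with
    | [], s0 =>
      refine ⟨_, _, Run.branch_nil s0 (key 1 (by omega) (by omega) s s0 s4), ?_, ?_⟩
      · rw [Function.update_self]; rfl
      · rw [s1]; omega
    | false :: z', s0 =>
      refine ⟨_, _, Run.branch_false (by rw [s0]; rfl) (Run.seq hc (key 2 (by omega) (by omega) _
        (by simp) (by simpa using s4))), ?_, ?_⟩
      · rw [Function.update_self, Function.update_of_ne (by omega)]; rfl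
      · rw [Function.update_of_ne (by omega), s2, s0]; omega
    | true :: z', s0 =>
      refine ⟨_, _, Run.branch_true (by rw [s0]; rfl) (Run.seq hc (key 3 (by omega) (by omega) _
        (by simp) (by simpa using s4))), ?_, ?_⟩
      · rw [Function.update_self, Function.update_of_ne (by omega)]; rfl
      · rw [Function.update_of_ne (by omega), s3, s0]; omega
  · simp [hz, hf, hg, hh]

/-- A counting loop with a state of two strings of polynomial length. -/
theorem PolyFun.iter₂ {cnt : α → List Bool} (hcnt : PolyFun D inp cnt)
    (σ τ : α → ℕ → List Bool) (hσ0 : PolyFun D inp (σ · 0)) (hτ0 : PolyFun D inp (τ · 0))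
    {bσ bτ : α → ℕ} (hbσ : PolyBdd D inp bσ) (hbτ : PolyBdd D inp bτ)
    (hσ : ∀ a ∈ D, ∀ i ≤ (cnt a).length, (σ a i).length ≤ bσ a)
    (hτ : ∀ a ∈ D, ∀ i ≤ (cnt a).length, (τ a i).length ≤ bτ a)
    (hstep : ∀ (D' : Set (α × ℕ)) (inp' : α × ℕ → List (List Bool)),
      (∀ p ∈ D', p.1 ∈ D ∧ p.2 < (cnt p.1).length) →
      (∀ f, PolyFun D inp f → PolyFun D' inp' (fun p => f p.1)) →
      PolyFun D' inp' (fun p => σ p.1 p.2) → PolyFun D' inp' (fun p => τ p.1 p.2) →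
      PolyFun D' inp' (fun p => σ p.1 (p.2 + 1)) ∧ PolyFun D' inp' (fun p => τ p.1 (p.2 + 1))) :
    PolyFun D inp (fun a => σ a (cnt a).length) ∧ PolyFun D inp (fun a => τ a (cnt a).length) := by
  obtain ⟨⟨k, hk⟩, hc⟩ := hcnt
  set D' : Set (α × ℕ) := {p | p.1 ∈ D ∧ p.2 < (cnt p.1).length} with hD'
  let ρ : α → ℕ → ℕ → List Bool := fun a i j => if j = 0 then σ a i else τ a i
  let inp' : α × ℕ → List (List Bool) := fun p => inp p.1 ++ (List.range 2).map (ρ p.1 p.2)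
  have hk' : ∀ p ∈ D', (inp' p).length = k + 2 := by
    rintro p hp
    simp [inp', hk _ hp.1]
  have hlift : ∀ f, PolyFun D inp f → PolyFun D' inp' (fun p => f p.1) := by
    intro f hf
    refine ⟨⟨_, hk'⟩, PolyTimeOn.comp hk' (f := fun j p => (inp' p).getD j []) (l := k)
      (fun j _ => (PolyFun.input ⟨_, hk'⟩ j).2) hf.2 Prod.fst (fun p hp => hp.1) fun p hp => ?_⟩
    apply List.ext_getElem (by simp [hk _ hp.1])
    intro i h1 h2
    simp [inp', List.getElem?_append_left h1, h1]
  have hin : ∀ j < 2, PolyFun D' inp' (fun p => ρ p.1 p.2 j) := fun j hj =>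
    (PolyFun.input ⟨_, hk'⟩ (k + j)).congr fun p hp => by
      simp only [inp']
      rw [List.getD_append_right _ _ _ _ (by rw [hk _ hp.1]; omega), hk _ hp.1]
      simp [hj]
  -- `hstep` is demanded for arbitrary `D'` and `inp'`, known only through the lifting property and
  -- the computability of the current state. Callers thus combine closure properties and never
  -- handle the concatenated input list, which enters only here.
  obtain ⟨h1, h2⟩ := hstep D' inp' (fun p hp => hp) hlift (hin 0 (by omega)) (hin 1 (by omega))
  obtain ⟨b1, hb1⟩ := hbσ
  obtain ⟨b2, hb2⟩ := hbτ
  have key : ∀ j < 2, PolyTimeOn D inp (fun a => ρ a (cnt a).length j) := fun j hj => by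
    refine PolyTimeOn.iterate hk ρ hc (l := 2) ?_ ?_ (b1 + b2) ?_ hj
    · intro j hj
      by_cases h : j = 0
      · simpa [ρ, h] using hσ0.2
      · simpa [ρ, h] using hτ0.2
    · intro j hj
      by_cases h : j = 0
      · simpa [ρ, h] using h1.2
      · simpa [ρ, h] using h2.2
    · intro a ha i hi j hj
      have e1 := hσ a ha i hi
      have e2 := hτ a ha i hi
      have e3 := hb1 a ha
      have e4 := hb2 a ha
      rw [Polynomial.eval_add]
      by_cases h : j = 0
      · simp only [ρ, h, if_true]; omega
      · simp only [ρ, h, if_false]; omega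
  exact ⟨⟨⟨k, hk⟩, key 0 (by omega)⟩, ⟨⟨k, hk⟩, key 1 (by omega)⟩⟩

theorem PolyFun.iter₁ {cnt : α → List Bool} (hcnt : PolyFun D inp cnt)
    (σ : α → ℕ → List Bool) (hσ0 : PolyFun D inp (σ · 0))
    {bσ : α → ℕ} (hbσ : PolyBdd D inp bσ)
    (hσ : ∀ a ∈ D, ∀ i ≤ (cnt a).length, (σ a i).length ≤ bσ a)
    (hstep : ∀ (D' : Set (α × ℕ)) (inp' : α × ℕ → List (List Bool)),
      (∀ p ∈ D', p.1 ∈ D ∧ p.2 < (cnt p.1).length) →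
      (∀ f, PolyFun D inp f → PolyFun D' inp' (fun p => f p.1)) →
      PolyFun D' inp' (fun p => σ p.1 p.2) → PolyFun D' inp' (fun p => σ p.1 (p.2 + 1))) :
    PolyFun D inp (fun a => σ a (cnt a).length) :=
  (PolyFun.iter₂ hcnt σ (fun _ _ => []) hσ0 (PolyFun.nil hcnt.1) hbσ (PolyBdd.const 0) hσ
    (fun _ _ _ _ => le_rfl) fun D' inp' hD hl h1 h2 => ⟨hstep D' inp' hD hl h1, h2⟩).1

end

/-! ## A library of polynomial-time functions -/

/-! ### Unary arithmetic and string operations -/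

@[simp] theorem length_unary (n : ℕ) : (unary n).length = n := by simp [unary]

theorem unary_succ (n : ℕ) : unary (n + 1) = true :: unary n := rfl

theorem unary_add (m n : ℕ) : unary (m + n) = unary m ++ unary n := by
  simp only [unary, List.replicate_append_replicate]

/-- Loops scan a string by keeping its unread suffix as the second state component; the current bit
is then the head, which `List.sel` can inspect. -/
theorem List.sel_drop {l : List Bool} {i : ℕ} (hi : i < l.length) (e f t : List Bool) :
    (l.drop i).sel e f t = if l[i] = true then t else f := by
  rw [List.drop_eq_getElem_cons hi]
  cases l[i] <;> rfl

theorem List.sel_drop_getD (l : List Bool) (i : ℕ) (s : List Bool) :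
    (l.drop i).sel (false :: s) (false :: s) (true :: s) = l.getD i false :: s := by
  by_cases hi : i < l.length
  · rw [List.sel_drop hi, List.getD_eq_getElem _ _ hi]
    cases l[i] <;> rfl
  · rw [List.drop_eq_nil_of_le (by omega), List.getD_eq_default _ _ (by omega)]
    rfl

section
variable {α : Type} {D : Set α} {inp : α → List (List Bool)} {f g : α → List Bool} {u v : α → ℕ}

theorem PolyFun.revAppend (hf : PolyFun D inp f) (hg : PolyFun D inp g) :
    PolyFun D inp (fun a => (f a).reverse ++ g a) := by
  refine (PolyFun.iter₂ hf (fun a i => ((f a).take i).reverse ++ g a) (fun a i => (f a).drop i)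
    (by simpa using hg) (by simpa using hf) (hf.bdd.add hg.bdd) hf.bdd ?_ ?_ ?_).1.congr ?_
  · intro a _ i _; simp
  · intro a _ i _; simp
  · intro D' inp' hD hl hσ hτ
    refine ⟨(hτ.sel hσ (hσ.cons false) (hσ.cons true)).congr fun p hp => ?_,
      hτ.tail.congr fun p hp => by simp⟩
    have := (hD p hp).2
    rw [List.sel_drop this, ← List.take_concat_get' _ _ this]
    cases (f p.1)[p.2] <;> simp
  · intro a _; simp

theorem PolyFun.reverse (hf : PolyFun D inp f) : PolyFun D inp (fun a => (f a).reverse) := by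
  simpa using hf.revAppend (PolyFun.nil hf.1)

theorem PolyFun.append (hf : PolyFun D inp f) (hg : PolyFun D inp g) :
    PolyFun D inp (fun a => f a ++ g a) := by
  simpa using hf.reverse.revAppend hg

theorem PolyFun.ulength (hf : PolyFun D inp f) : PolyFun D inp (fun a => unary (f a).length) :=
  PolyFun.iter₁ hf (fun _ i => unary i) (PolyFun.nil hf.1) hf.bdd (by simp) fun _ _ _ _ h =>
    h.cons true

/-- The number `u` can be computed, in unary, in polynomial time. -/
def PolyNat (D : Set α) (inp : α → List (List Bool)) (u : α → ℕ) : Prop :=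
  PolyFun D inp (fun a => unary (u a))

theorem PolyNat.bdd (hu : PolyNat D inp u) : PolyBdd D inp u := by
  simpa using PolyFun.bdd hu

theorem PolyNat.const (hk : ∃ k, ∀ a ∈ D, (inp a).length = k) (n : ℕ) :
    PolyNat D inp (fun _ => n) := PolyFun.const hk _

theorem PolyNat.add (hu : PolyNat D inp u) (hv : PolyNat D inp v) :
    PolyNat D inp (fun a => u a + v a) :=
  (PolyFun.append hu hv).congr fun _ _ => unary_add _ _

theorem PolyFun.loop₂ (hu : PolyNat D inp u)
    (σ τ : α → ℕ → List Bool) (hσ0 : PolyFun D inp (σ · 0)) (hτ0 : PolyFun D inp (τ · 0))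
    {bσ bτ : α → ℕ} (hbσ : PolyBdd D inp bσ) (hbτ : PolyBdd D inp bτ)
    (hσ : ∀ a ∈ D, ∀ i ≤ u a, (σ a i).length ≤ bσ a)
    (hτ : ∀ a ∈ D, ∀ i ≤ u a, (τ a i).length ≤ bτ a)
    (hstep : ∀ (D' : Set (α × ℕ)) (inp' : α × ℕ → List (List Bool)),
      (∀ p ∈ D', p.1 ∈ D ∧ p.2 < u p.1) →
      (∀ f, PolyFun D inp f → PolyFun D' inp' (fun p => f p.1)) →
      PolyFun D' inp' (fun p => σ p.1 p.2) → PolyFun D' inp' (fun p => τ p.1 p.2) →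
      PolyFun D' inp' (fun p => σ p.1 (p.2 + 1)) ∧ PolyFun D' inp' (fun p => τ p.1 (p.2 + 1))) :
    PolyFun D inp (fun a => σ a (u a)) ∧ PolyFun D inp (fun a => τ a (u a)) := by
  have := PolyFun.iter₂ hu σ τ hσ0 hτ0 hbσ hbτ (by simpa using hσ) (by simpa using hτ)
    (by simpa using hstep)
  simpa using this

theorem PolyFun.loop₁ (hu : PolyNat D inp u)
    (σ : α → ℕ → List Bool) (hσ0 : PolyFun D inp (σ · 0))
    {bσ : α → ℕ} (hbσ : PolyBdd D inp bσ)
    (hσ : ∀ a ∈ D, ∀ i ≤ u a, (σ a i).length ≤ bσ a)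
    (hstep : ∀ (D' : Set (α × ℕ)) (inp' : α × ℕ → List (List Bool)),
      (∀ p ∈ D', p.1 ∈ D ∧ p.2 < u p.1) →
      (∀ f, PolyFun D inp f → PolyFun D' inp' (fun p => f p.1)) →
      PolyFun D' inp' (fun p => σ p.1 p.2) → PolyFun D' inp' (fun p => σ p.1 (p.2 + 1))) :
    PolyFun D inp (fun a => σ a (u a)) := by
  have := PolyFun.iter₁ hu σ hσ0 hbσ (by simpa using hσ) (by simpa using hstep)
  simpa using this

theorem PolyNat.mul (hu : PolyNat D inp u) (hv : PolyNat D inp v) :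
    PolyNat D inp (fun a => u a * v a) := by
  refine PolyFun.loop₁ hu (fun a i => unary (i * v a)) ?_ (hu.bdd.mul hv.bdd) ?_ ?_
  · simpa [PolyNat] using PolyNat.const hu.1 0
  · intro a _ i hi
    rw [length_unary]
    exact Nat.mul_le_mul_right _ hi
  · intro D' inp' _ hl hσ
    refine (hσ.append (hl _ hv)).congr fun p _ => ?_
    rw [← unary_add, add_mul, one_mul]

theorem PolyNat.pow (hu : PolyNat D inp u) (n : ℕ) : PolyNat D inp (fun a => u a ^ n) := by
  induction n with
  | zero => simpa using PolyNat.const hu.1 1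
  | succ n ih => simpa only [pow_succ] using ih.mul hu

theorem PolyNat.eval (hu : PolyNat D inp u) (p : Polynomial ℕ) :
    PolyNat D inp (fun a => p.eval (u a)) := by
  induction p using Polynomial.induction_on' with
  | add p q hp hq => simpa only [Polynomial.eval_add] using hp.add hq
  | monomial n c =>
    simpa only [Polynomial.eval_monomial] using (PolyNat.const hu.1 c).mul (hu.pow n)

theorem PolyFun.drop (hu : PolyNat D inp u) (hf : PolyFun D inp f) :
    PolyFun D inp (fun a => (f a).drop (u a)) :=
  PolyFun.loop₁ hu (fun a i => (f a).drop i) (by simpa using hf) hf.bdd (by simp)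
    fun _ _ _ _ h => h.tail.congr fun p _ => by simp

/-- The first `n` bits of `l`, padded with zeros. -/
def padTake (n : ℕ) (l : List Bool) : List Bool := (List.range n).map fun i => l.getD i false

@[simp] theorem length_padTake (n : ℕ) (l : List Bool) : (padTake n l).length = n := by
  simp [padTake]

theorem padTake_succ (n : ℕ) (l : List Bool) :
    padTake (n + 1) l = padTake n l ++ [l.getD n false] := by
  simp [padTake, List.range_succ]

theorem padTake_eq_take {n : ℕ} {l : List Bool} (h : n ≤ l.length) : padTake n l = l.take n := by
  apply List.ext_getElem (by simp [h])
  intro i h1 h2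
  simp at h1
  simp [padTake, show i < l.length by omega]

theorem PolyFun.padTake (hu : PolyNat D inp u) (hf : PolyFun D inp f) :
    PolyFun D inp (fun a => padTake (u a) (f a)) := by
  refine (PolyFun.loop₂ hu (fun a i => (_root_.padTake i (f a)).reverse) (fun a i => (f a).drop i)
    (PolyFun.nil hu.1) (by simpa using hf) hu.bdd hf.bdd ?_ ?_ ?_).1.reverse.congr ?_
  · intro a _ i hi; simpa using hi
  · intro a _ i _; simp
  · intro D' inp' hD hl hσ hτ
    refine ⟨(hτ.sel (hσ.cons false) (hσ.cons false) (hσ.cons true)).congr fun p hp => ?_,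
      hτ.tail.congr fun p hp => by simp⟩
    rw [List.sel_drop_getD, padTake_succ]
    simp
  · intro a _; simp

/-! ### Binary values and logarithms -/

/-- The number with binary digits `l`, most significant digit first. -/
def bitsVal (l : List Bool) : ℕ := l.foldl (fun v b => 2 * v + b.toNat) 0

theorem bitsVal_concat (l : List Bool) (b : Bool) : bitsVal (l ++ [b]) = 2 * bitsVal l + b.toNat := by
  simp [bitsVal]

theorem bitsVal_lt (l : List Bool) : bitsVal l < 2 ^ l.length := by
  induction l using List.reverseRecOn with
  | nil => simp [bitsVal]
  | append_singleton l b ih =>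
    rw [bitsVal_concat, List.length_append, List.length_singleton, pow_succ]
    have := b.toNat_le
    omega

/-- Horner's scheme, with doubling as concatenation. The unary value may be exponentially long in
general, hence the computable bound `u`. -/
theorem PolyNat.bitsVal (hf : PolyFun D inp f) (hu : PolyNat D inp u)
    (h : ∀ a ∈ D, 2 ^ (f a).length ≤ u a) : PolyNat D inp (fun a => bitsVal (f a)) := by
  refine (PolyFun.iter₂ hf (fun a i => unary (_root_.bitsVal ((f a).take i)))
    (fun a i => (f a).drop i) (PolyFun.nil hu.1) (by simpa using hf) hu.bdd hf.bdd ?_ ?_ ?_).1.congr ?_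
  · intro a ha i _
    rw [length_unary]
    refine (bitsVal_lt _).le.trans (le_trans (Nat.pow_le_pow_right (by norm_num) ?_) (h a ha))
    simp
  · intro a _ i _; simp
  · intro D' inp' hD hl hσ hτ
    refine ⟨(hτ.sel hσ (hσ.append hσ) ((hσ.append hσ).cons true)).congr fun p hp => ?_,
      hτ.tail.congr fun p hp => by simp⟩
    have := (hD p hp).2
    rw [List.sel_drop this, ← List.take_concat_get' _ _ this, bitsVal_concat, ← unary_add]
    cases (f p.1)[p.2]
    · simp [two_mul]
    · simp [two_mul, unary_succ]
  · intro a _; simp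

/-- A power of two is doubled while it is smaller than the length `L`; this is tested by dropping `2
^ i` bits and looking whether any are left. The `min` freezes the state afterwards, so the loop can
simply run `L` times. The state stays below `2 * L + 1` because `2 ^ (Nat.clog 2 L - 1) < L` for `1
< L`, and the power is `1` otherwise. -/
theorem PolyNat.clog (hf : PolyFun D inp f) :
    PolyNat D inp (fun a => 2 ^ Nat.clog 2 (f a).length) ∧
      PolyNat D inp (fun a => Nat.clog 2 (f a).length) := by
  have hle : ∀ L, Nat.clog 2 L ≤ L := fun L => Nat.clog_le_of_le_pow Nat.lt_two_pow_self.le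
  have := PolyFun.iter₂ hf (fun a i => unary (2 ^ min i (Nat.clog 2 (f a).length)))
    (fun a i => unary (min i (Nat.clog 2 (f a).length))) (by simpa [PolyNat] using PolyNat.const hf.1 1)
    (by simpa [PolyNat] using PolyNat.const hf.1 0)
    (((PolyBdd.const 2).mul hf.bdd).add (PolyBdd.const 1)) hf.bdd ?_ ?_ ?_
  · simpa only [PolyNat, min_eq_right (hle _)] using this
  · intro a _ i _
    rw [length_unary]
    refine (Nat.pow_le_pow_right (by norm_num) (min_le_right _ _)).trans ?_
    by_cases h : 1 < (f a).length
    · have h1 := Nat.pow_pred_clog_lt_self (b := 2) (by norm_num) h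
      have h2 := Nat.clog_pos (b := 2) (by norm_num) h
      obtain ⟨c, hc⟩ : ∃ c, Nat.clog 2 (f a).length = c + 1 := ⟨_, (Nat.succ_pred_eq_of_pos h2).symm⟩
      rw [hc] at h1 ⊢
      simp only [Nat.pred_succ] at h1
      rw [pow_succ]
      omega
    · rw [Nat.clog_of_right_le_one (by omega)]
      simp
  · intro a _ i hi
    rw [length_unary]
    exact (min_le_left _ _).trans hi
  · intro D' inp' hD hl hσ hτ
    have hz := PolyFun.drop hσ (hl _ hf)
    have key : ∀ p ∈ D', ∀ e t : List Bool,
        ((f p.1).drop (2 ^ min p.2 (Nat.clog 2 (f p.1).length))).sel e t t =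
          if p.2 < Nat.clog 2 (f p.1).length then t else e := by
      intro p hp e t
      by_cases h : p.2 < Nat.clog 2 (f p.1).length
      · rw [if_pos h, min_eq_left h.le]
        have h2 : 2 ^ p.2 < (f p.1).length := (Nat.lt_clog_iff_pow_lt (by norm_num)).1 h
        rw [List.sel_drop h2]
        simp
      · rw [if_neg h, min_eq_right (by omega), List.drop_eq_nil_of_le]
        · rfl
        · exact Nat.le_pow_clog (by norm_num) _
    refine ⟨(hz.sel hσ (hσ.append hσ) (hσ.append hσ)).congr fun p hp => ?_,
      (hz.sel hτ (hτ.cons true) (hτ.cons true)).congr fun p hp => ?_⟩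
    · rw [key p hp]
      split_ifs with h
      · rw [min_eq_left h.le, min_eq_left (by omega), ← unary_add, pow_succ, mul_two]
      · rw [min_eq_right (by omega), min_eq_right (by omega)]
    · rw [key p hp]
      split_ifs with h
      · rw [min_eq_left h.le, min_eq_left (by omega), unary_succ]
      · rw [min_eq_right (by omega), min_eq_right (by omega)]

/-! ### Parsing -/

/-- One step of the parser for `encList`: read one more bit of the first string. -/
def decStep : List Bool × List Bool → List Bool × List Bool
  | (true :: b :: z, acc) => (z, b :: acc)
  | s => s

/-- The first string of an encoded list. -/
def decFirst (z : List Bool) : List Bool := (decStep^[z.length] (z, [])).2.reverse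

/-- The encoding of the remaining strings of an encoded list. -/
def decRest (z : List Bool) : List Bool := (decStep^[z.length] (z, [])).1.tail

/-- A leading `false` is a fixed point of the parser, so surplus iterations do no harm and the
length of the input serves as the iteration count. -/
theorem decStep_iterate (x w acc : List Bool) (n : ℕ) (hn : x.length ≤ n) :
    decStep^[n] ((x.flatMap fun b => [true, b]) ++ false :: w, acc) =
      (false :: w, x.reverse ++ acc) := by
  induction x generalizing acc n with
  | nil => exact Function.iterate_fixed rfl n
  | cons b x ih =>
    obtain ⟨n, rfl⟩ : ∃ m, n = m + 1 := ⟨n - 1, by simp at hn; omega⟩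
    rw [Function.iterate_succ_apply]
    simp only [List.flatMap_cons, List.cons_append, List.nil_append, decStep]
    rw [ih _ _ (by simpa using hn)]
    simp

theorem encList_cons (x : List Bool) (xs : List (List Bool)) :
    encList (x :: xs) = (x.flatMap fun b => [true, b]) ++ false :: encList xs := by
  simp [encList]

theorem length_le_encList_cons (x : List Bool) (xs : List (List Bool)) :
    x.length + (encList xs).length < (encList (x :: xs)).length := by
  rw [encList_cons]
  simp
  omega

theorem decFirst_encList (x : List Bool) (xs : List (List Bool)) :
    decFirst (encList (x :: xs)) = x := by
  have h := length_le_encList_cons x xs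
  rw [decFirst]
  generalize (encList (x :: xs)).length = n at h
  rw [encList_cons, decStep_iterate _ _ _ _ (by omega)]
  simp

theorem decRest_encList (x : List Bool) (xs : List (List Bool)) :
    decRest (encList (x :: xs)) = encList xs := by
  have h := length_le_encList_cons x xs
  rw [decRest]
  generalize (encList (x :: xs)).length = n at h
  rw [encList_cons, decStep_iterate _ _ _ _ (by omega)]
  simp

/-- Pattern matching is rewritten as nested selections, to which `PolyFun.sel` applies. -/
theorem decStep_fst (z acc : List Bool) :
    (decStep (z, acc)).1 = z.sel z z (z.tail.sel z z.tail.tail z.tail.tail) := by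
  rcases z with _ | ⟨_ | _, _ | ⟨_ | _, z⟩⟩ <;> rfl

theorem decStep_snd (z acc : List Bool) :
    (decStep (z, acc)).2 = z.sel acc acc (z.tail.sel acc (false :: acc) (true :: acc)) := by
  rcases z with _ | ⟨_ | _, _ | ⟨_ | _, z⟩⟩ <;> rfl

theorem decStep_length (s : List Bool × List Bool) :
    (decStep s).1.length + (decStep s).2.length ≤ s.1.length + s.2.length := by
  obtain ⟨z, acc⟩ := s
  rcases z with _ | ⟨_ | _, _ | ⟨b, z⟩⟩ <;> (simp [decStep]; try omega)

theorem decStep_iterate_length (s : List Bool × List Bool) (n : ℕ) :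
    (decStep^[n] s).1.length + (decStep^[n] s).2.length ≤ s.1.length + s.2.length := by
  induction n with
  | zero => simp
  | succ n ih =>
    rw [Function.iterate_succ_apply']
    exact (decStep_length _).trans ih

theorem PolyFun.dec (hf : PolyFun D inp f) :
    PolyFun D inp (fun a => decFirst (f a)) ∧ PolyFun D inp (fun a => decRest (f a)) := by
  have := PolyFun.iter₂ hf (fun a i => (decStep^[i] (f a, [])).1)
    (fun a i => (decStep^[i] (f a, [])).2) hf (PolyFun.nil hf.1) hf.bdd hf.bdd
    (fun a _ i _ => by
      have := decStep_iterate_length (f a, []) i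
      simp only [List.length_nil] at this
      omega)
    (fun a _ i _ => by
      have := decStep_iterate_length (f a, []) i
      simp only [List.length_nil] at this
      omega) fun D' inp' hD hl hσ hτ => ⟨
      (hσ.sel hσ hσ (hσ.tail.sel hσ hσ.tail.tail hσ.tail.tail)).congr fun p _ => by
        rw [Function.iterate_succ_apply', ← decStep_fst],
      (hσ.sel hτ hτ (hσ.tail.sel hτ (hτ.cons false) (hτ.cons true))).congr fun p _ => by
        rw [Function.iterate_succ_apply', ← decStep_snd]⟩
  exact ⟨this.2.reverse, this.1.tail⟩

/-- Precede every bit by `true`. -/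
theorem PolyFun.flatMapTrue (hf : PolyFun D inp f) :
    PolyFun D inp (fun a => (f a).flatMap fun b => [true, b]) := by
  refine (PolyFun.iter₂ hf (fun a i => ((f a).take i).flatMap fun b => [true, b])
    (fun a i => (f a).drop i) (PolyFun.nil hf.1) (by simpa using hf)
    ((PolyBdd.const 2).mul hf.bdd) hf.bdd ?_ ?_ ?_).1.congr ?_
  · intro a _ i _; simp; omega
  · intro a _ i _; simp
  · intro D' inp' hD hl hσ hτ
    refine ⟨(hσ.append (hτ.sel (PolyFun.nil hτ.1) (PolyFun.const hτ.1 [true, false])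
      (PolyFun.const hτ.1 [true, true]))).congr fun p hp => ?_, hτ.tail.congr fun p hp => by simp⟩
    have := (hD p hp).2
    rw [List.sel_drop this, ← List.take_concat_get' _ _ this]
    cases (f p.1)[p.2] <;> simp
  · intro a _; simp

theorem PolyFun.encList_cons {F : α → List (List Bool)} (hf : PolyFun D inp f)
    (hF : PolyFun D inp (fun a => encList (F a))) :
    PolyFun D inp (fun a => encList (f a :: F a)) :=
  (hf.flatMapTrue.append (hF.cons false)).congr fun _ _ => _root_.encList_cons _ _

/-! ### Tests -/

theorem PolyFun.and {p q : α → Bool} (hp : PolyFun D inp (fun a => [p a]))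
    (hq : PolyFun D inp (fun a => [q a])) : PolyFun D inp (fun a => [p a && q a]) :=
  (hp.sel hp hp hq).congr fun a _ => by
    cases p a <;> simp [List.sel]

/-- While the part of `f a` read so far is a prefix of `g a`, the state is `true` followed by the
rest of `g a`; after a mismatch it is empty for good. The marker `true` distinguishes an exhausted
`g a` from a failure, and equality means that exactly the marker is left. -/
theorem PolyFun.eq (hf : PolyFun D inp f) (hg : PolyFun D inp g) :
    PolyFun D inp (fun a => [decide (f a = g a)]) := by
  have h := (PolyFun.iter₂ hf
    (fun a i => if (f a).take i <+: g a then true :: (g a).drop i else [])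
    (fun a i => (f a).drop i) (by simpa using hg.cons true) (by simpa using hf)
    (hg.bdd.add (PolyBdd.const 1)) hf.bdd ?_ ?_ ?_).1
  · refine (h.sel (PolyFun.const h.1 [false]) (PolyFun.const h.1 [false]) (h.tail.sel
      (PolyFun.const h.1 [true]) (PolyFun.const h.1 [false]) (PolyFun.const h.1 [false]))).congr
      fun a _ => ?_
    rw [List.take_length]
    by_cases hp : f a <+: g a
    · obtain ⟨t, ht⟩ := hp
      rw [← ht]
      rcases t with _ | ⟨_ | _, t⟩ <;> simp [List.sel]
    · have : f a ≠ g a := fun h => hp (h ▸ List.prefix_refl _)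
      simp [hp, this, List.sel]
  · intro a _ i _
    split_ifs <;> simp
  · intro a _ i _; simp
  · intro D' inp' hD hl hσ hτ
    have hn := PolyFun.nil hσ.1
    refine ⟨(hσ.sel hn hn (hτ.sel hn (hσ.tail.sel hn (hσ.tail.tail.cons true) hn)
      (hσ.tail.sel hn hn (hσ.tail.tail.cons true)))).congr fun p hp => ?_,
      hτ.tail.congr fun p hp => by simp⟩
    have hi := (hD p hp).2
    rw [List.sel_drop hi, ← List.take_concat_get' _ _ hi]
    by_cases h : (f p.1).take p.2 <+: g p.1
    · rw [if_pos h]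
      obtain ⟨t, ht⟩ := h
      have hlen : ((f p.1).take p.2).length = p.2 := by simp; omega
      have e1 : ((f p.1).take p.2 ++ t).drop p.2 = t := by
        rw [List.drop_append, hlen, List.drop_eq_nil_of_le hlen.le]
        simp
      have e2 : ((f p.1).take p.2 ++ t).drop (p.2 + 1) = t.tail := by
        rw [← List.tail_drop, e1]
      rw [← ht, e1, e2]
      simp only [List.prefix_append_right_inj]
      rcases t with _ | ⟨_ | _, t⟩ <;> cases (f p.1)[p.2] <;> simp [List.sel]
    · rw [if_neg h, if_neg]
      · rfl
      · exact fun h' => h ((List.prefix_append _ _).trans h')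

/-- A budget of `u a + 1` is reduced by one for each `true`; because of the `+ 1` it is still
positive at the end exactly if the count is at most `u a`. -/
theorem PolyFun.count_le (hf : PolyFun D inp f) (hu : PolyNat D inp u) :
    PolyFun D inp (fun a => [decide ((f a).count true ≤ u a)]) := by
  have h := (PolyFun.iter₂ hf (fun a i => unary (u a + 1 - ((f a).take i).count true))
    (fun a i => (f a).drop i) (by simpa [PolyNat] using hu.add (PolyNat.const hu.1 1)) (by simpa using hf)
    (hu.bdd.add (PolyBdd.const 1)) hf.bdd ?_ ?_ ?_).1
  · refine (h.sel (PolyFun.const h.1 [false]) (PolyFun.const h.1 [false])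
      (PolyFun.const h.1 [true])).congr fun a _ => ?_
    rw [List.take_length]
    by_cases hp : (f a).count true ≤ u a
    · rw [show u a + 1 - (f a).count true = (u a - (f a).count true) + 1 by omega, unary_succ]
      simp [List.sel, hp]
    · rw [show u a + 1 - (f a).count true = 0 by omega]
      simp [List.sel, unary, hp]
  · intro a _ i _; simp
  · intro a _ i _; simp
  · intro D' inp' hD hl hσ hτ
    refine ⟨(hτ.sel hσ hσ hσ.tail).congr fun p hp => ?_, hτ.tail.congr fun p hp => by simp⟩
    have hi := (hD p hp).2
    rw [List.sel_drop hi, ← List.take_concat_get' _ _ hi]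
    cases (f p.1)[p.2]
    · simp
    · simp [unary, Nat.sub_sub]

/-! ### Weight vectors -/

/-- The encoding of the weight vector of length `n` whose only nonzero entry is a `1` at position
`u`. -/
def encOneHot (n u : ℕ) : List Bool :=
  (List.range n).flatMap fun i => if i = u then [true, true, false, true, true, false] else
    [false, true, true, false]

theorem length_encOneHot_le (n u : ℕ) : (encOneHot n u).length ≤ n * 6 := by
  have : ∀ l : List ℕ, (l.flatMap fun i => if i = u then [true, true, false, true, true, false] else
    [false, true, true, false]).length ≤ l.length * 6 := by
    intro l
    induction l with
    | nil => simp
    | cons i l ih =>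
      rw [List.flatMap_cons, List.length_append, List.length_cons]
      split_ifs <;> simp only [List.length_cons, List.length_nil] <;> omega
  simpa [encOneHot] using this (List.range n)

/-- The second state component runs through `unary v ++ [false]`: its head is `true` before position
`v`, `false` exactly at `v`, and missing afterwards. The sentinel thus replaces a comparison of
numbers. -/
theorem PolyFun.encOneHot (hu : PolyNat D inp u) (hv : PolyNat D inp v) :
    PolyFun D inp (fun a => encOneHot (u a) (v a)) := by
  have hv' := PolyFun.append hv (PolyFun.const hv.1 [false])
  refine (PolyFun.loop₂ hu (fun a i => _root_.encOneHot i (v a))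
    (fun a i => (unary (v a) ++ [false]).drop i) (PolyFun.nil hu.1) (by simpa using hv')
    (hu.bdd.mul (PolyBdd.const 6)) hv'.bdd ?_ ?_ ?_).1
  · intro a _ i hi
    exact (length_encOneHot_le _ _).trans (Nat.mul_le_mul_right _ hi)
  · intro a _ i _; simp
  · intro D' inp' hD hl hσ hτ
    have h0 := PolyFun.const hσ.1 [false, true, true, false]
    refine ⟨(hσ.append (hτ.sel h0 (PolyFun.const hσ.1 [true, true, false, true, true, false])
      h0)).congr fun p hp => ?_, hτ.tail.congr fun p hp => by simp⟩
    rw [_root_.encOneHot, List.range_succ, List.flatMap_append]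
    refine congrArg₂ _ rfl ?_
    rcases lt_trichotomy p.2 (v p.1) with h | h | h
    · rw [List.sel_drop (by simp; omega)]
      rw [List.getElem_append_left (by simpa using h)]
      simp [unary, h.ne]
    · rw [List.sel_drop (by simp; omega), List.getElem_append_right (by simp; omega)]
      simp [h]
    · rw [List.drop_eq_nil_of_le (by simp; omega)]
      simp [h.ne', List.sel]

/-- The encoding of the `t` one-hot weight vectors of length `n` whose positions are given by
consecutive blocks of `m` bits of `r`. -/
def encOneHots (n m t : ℕ) (r : List Bool) : List Bool :=
  (List.range t).flatMap fun s => encOneHot n (bitsVal (padTake m (r.drop (s * m))))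

/-- `hm2` is what allows the positions, which are given in binary, to be expanded to unary. -/
theorem PolyFun.encOneHots {n m t : α → ℕ} (hn : PolyNat D inp n) (hm : PolyNat D inp m)
    (hm2 : PolyNat D inp (fun a => 2 ^ m a)) (ht : PolyNat D inp t) (hf : PolyFun D inp f) :
    PolyFun D inp (fun a => encOneHots (n a) (m a) (t a) (f a)) := by
  refine (PolyFun.loop₂ ht (fun a i => _root_.encOneHots (n a) (m a) i (f a))
    (fun a i => (f a).drop (i * m a)) (PolyFun.nil hf.1) (by simpa using hf)
    (ht.bdd.mul (hn.bdd.mul (PolyBdd.const 6))) hf.bdd ?_ ?_ ?_).1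
  · intro a _ i hi
    refine le_trans ?_ (Nat.mul_le_mul_right _ hi)
    induction i with
    | zero => simp [_root_.encOneHots]
    | succ i ih =>
      have := ih (by omega)
      rw [_root_.encOneHots] at this ⊢
      rw [List.range_succ, List.flatMap_append, List.length_append, add_mul]
      have h2 := length_encOneHot_le (n a) (_root_.bitsVal (_root_.padTake (m a) ((f a).drop (i * m a))))
      simp only [List.flatMap_cons, List.flatMap_nil, List.append_nil]
      omega
  · intro a _ i _; simp
  · intro D' inp' hD hl hσ hτ
    refine ⟨(hσ.append (PolyFun.encOneHot (hl _ hn) (PolyNat.bitsVal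
      (PolyFun.padTake (hl _ hm) hτ) (hl _ hm2) (fun p _ => by simp)))).congr fun p hp => ?_,
      (PolyFun.drop (hl _ hm) hτ).congr fun p hp => ?_⟩
    · simp [_root_.encOneHots, List.range_succ, List.flatMap_append]
    · rw [List.drop_drop, add_mul, one_mul]

end

/-! ## Averages over fair coins -/

/-- The average of `F` over all bit strings of length `N`. -/
noncomputable def coinAvg (N : ℕ) (F : List Bool → ℝ) : ℝ := 𝔼 r : Fin N → Bool, F (List.ofFn r)

theorem coinAvg_zero (F : List Bool → ℝ) : coinAvg 0 F = F [] := by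
  simp [coinAvg]

theorem coinAvg_succ (N : ℕ) (F : List Bool → ℝ) :
    coinAvg (N + 1) F =
      (coinAvg N (fun r => F (false :: r)) + coinAvg N (fun r => F (true :: r))) / 2 := by
  simp only [coinAvg, Fintype.expect_eq_sum_div_card]
  rw [← Fintype.sum_equiv (Fin.consEquiv fun _ => Bool)
    (fun p => F (List.ofFn (Fin.consEquiv (fun _ => Bool) p))) _ fun _ => rfl]
  rw [Fintype.sum_prod_type, Fintype.sum_bool]
  simp [Fin.consEquiv, List.ofFn_succ, pow_succ]
  ring

theorem coinAvg_congr {N : ℕ} {F G : List Bool → ℝ} (h : ∀ r, r.length = N → F r = G r) :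
    coinAvg N F = coinAvg N G :=
  Finset.expect_congr rfl fun r _ => h _ (by simp)

theorem coinAvg_mono {N : ℕ} {F G : List Bool → ℝ} (h : ∀ r, r.length = N → F r ≤ G r) :
    coinAvg N F ≤ coinAvg N G :=
  Finset.expect_le_expect fun r _ => h _ (by simp)

theorem coinAvg_const (N : ℕ) (c : ℝ) : coinAvg N (fun _ => c) = c := by
  simp [coinAvg]

theorem coinAvg_plus (N : ℕ) (F G : List Bool → ℝ) :
    coinAvg N (fun r => F r + G r) = coinAvg N F + coinAvg N G := by
  simp [coinAvg, Finset.expect_add_distrib]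

theorem coinAvg_sub (N : ℕ) (F G : List Bool → ℝ) :
    coinAvg N (fun r => F r - G r) = coinAvg N F - coinAvg N G := by
  simp [coinAvg, Finset.expect_sub_distrib]

theorem coinAvg_div (N : ℕ) (F : List Bool → ℝ) (c : ℝ) :
    coinAvg N (fun r => F r / c) = coinAvg N F / c := by
  simp [coinAvg, Finset.expect_div]

theorem coinAvg_sum {ι : Type} (N : ℕ) (s : Finset ι) (F : ι → List Bool → ℝ) :
    coinAvg N (fun r => ∑ i ∈ s, F i r) = ∑ i ∈ s, coinAvg N (F i) := by
  simp [coinAvg, Finset.expect_sum_comm]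

theorem coinAvg_comm (N M : ℕ) (F : List Bool → List Bool → ℝ) :
    coinAvg N (fun r => coinAvg M (F r)) = coinAvg M (fun r' => coinAvg N (fun r => F r r')) :=
  Finset.expect_comm _ _ _

/-- Consecutive blocks of coins are independent. All later conditioning arguments split the coin
string in this way. -/
theorem coinAvg_add (a b : ℕ) (F : List Bool → ℝ) :
    coinAvg (a + b) F = coinAvg a (fun r => coinAvg b (fun r' => F (r ++ r'))) := by
  induction a generalizing F with
  | zero => simp [coinAvg_zero]
  | succ a ih =>
    rw [show a + 1 + b = (a + b) + 1 by omega, coinAvg_succ, coinAvg_succ, ih, ih]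
    rfl

theorem coinAvg_take {a N : ℕ} (h : a ≤ N) (F : List Bool → ℝ) :
    coinAvg N (fun r => F (r.take a)) = coinAvg a F := by
  obtain ⟨b, rfl⟩ := Nat.exists_eq_add_of_le h
  rw [coinAvg_add]
  refine coinAvg_congr fun r hr => ?_
  rw [← coinAvg_const b (F r)]
  refine coinAvg_congr fun r' _ => ?_
  rw [← hr, List.take_left]

/-- `m` fair bits, read in binary, are uniform on the numbers below `2 ^ m`. -/
theorem coinAvg_bitsVal (m : ℕ) (F : ℕ → ℝ) :
    coinAvg m (fun r => F (bitsVal r)) = (∑ v ∈ Finset.range (2 ^ m), F v) / 2 ^ m := by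
  induction m generalizing F with
  | zero => simp [coinAvg_zero, bitsVal]
  | succ m ih =>
    have h2 : ∀ n, ∑ v ∈ Finset.range (2 * n), F v =
        ∑ v ∈ Finset.range n, (F (2 * v) + F (2 * v + 1)) := by
      intro n
      induction n with
      | zero => simp
      | succ n ih =>
        rw [Finset.sum_range_succ, ← ih, show 2 * (n + 1) = 2 * n + 1 + 1 by ring,
          Finset.sum_range_succ, Finset.sum_range_succ]
        ring
    rw [coinAvg_add]
    -- Averaging over the last bit replaces `F v` by the mean of `F (2 * v)` and `F (2 * v + 1)`.
    have := ih fun v => (F (2 * v) + F (2 * v + 1)) / 2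
    rw [← Finset.sum_div, ← h2] at this
    rw [pow_succ, mul_comm (2 ^ m) 2, pow_succ, mul_comm (2 ^ m) (2 : ℝ), ← div_div, ← this]
    refine coinAvg_congr fun r _ => ?_
    rw [coinAvg_succ, coinAvg_zero, coinAvg_zero, bitsVal_concat, bitsVal_concat]
    simp

theorem coinAvg_indicator (N : ℕ) (p : List Bool → Prop) [DecidablePred p] :
    coinAvg N (fun r => if p r then 1 else 0) =
      ((Finset.univ.filter fun r : Fin N → Bool => p (List.ofFn r)).dens : ℝ) := by
  simp [coinAvg, Fintype.expect_eq_sum_div_card, Finset.dens]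

/-! ## Random one-hot weights -/

/-- The weight vector with a single `1` at position `u`. -/
def oneHot (n u : ℕ) : Fin n → ℚ≥0 := fun i => if i.val = u then 1 else 0

/-- The one-hot weight vectors given by consecutive blocks of `m` bits of `r`. -/
def blockWeights (n m : ℕ) (r : List Bool) (s : ℕ) : Fin n → ℚ≥0 :=
  oneHot n (bitsVal (padTake m (r.drop (s * m))))

theorem normalized_oneHot (n u : ℕ) : Normalized (oneHot n u) := by
  intro i
  rw [oneHot]
  split_ifs <;> simp

/-- With at most one nonzero weight, maximum and sum coincide. So the cost is additive over the
elements of `S`, and its expectation can detect the cardinality. -/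
theorem maxCost_oneHot {n : ℕ} (u : ℕ) (S : Finset (Fin n)) :
    maxCost (oneHot n u) S = ∑ i ∈ S, if i.val = u then 1 else 0 := by
  have hsup : S.sup (oneHot n u) = if ∃ i ∈ S, i.val = u then 1 else 0 := by
    split_ifs with h
    · obtain ⟨i, hi, hu⟩ := h
      refine le_antisymm (Finset.sup_le fun j _ => normalized_oneHot n u j) ?_
      have := Finset.le_sup (f := oneHot n u) hi
      rwa [oneHot, if_pos hu] at this
    · refine le_antisymm (Finset.sup_le fun j hj => ?_) (by simp)
      rw [oneHot, if_neg fun hu => h ⟨j, hj, hu⟩]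
  rw [maxCost, hsup]
  split_ifs with h
  · obtain ⟨i, hi, hu⟩ := h
    rw [Finset.sum_eq_single_of_mem i hi]
    · simp [hu]
    · intro j _ hj
      rw [if_neg]
      intro hju
      exact hj (Fin.ext (hju.trans hu.symm))
  · rw [Finset.sum_eq_zero]
    · simp
    · intro i hi
      rw [if_neg fun hu => h ⟨i, hi, hu⟩]

/-- Each element is hit with probability exactly `2 ^ (-m)`; numbers from `n` on produce the zero
vector. The denominator `2 ^ m` does not depend on `S`. -/
theorem coinAvg_maxCost_oneHot {n m : ℕ} (hn : n ≤ 2 ^ m) (S : Finset (Fin n)) :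
    coinAvg m (fun r => maxCost (oneHot n (bitsVal r)) S) = (S.card : ℝ) / 2 ^ m := by
  rw [coinAvg_bitsVal m fun u => maxCost (oneHot n u) S]
  congr 1
  simp only [maxCost_oneHot]
  rw [Finset.sum_comm, Finset.card_eq_sum_ones, Nat.cast_sum]
  refine Finset.sum_congr rfl fun i _ => ?_
  have : i.val < 2 ^ m := lt_of_lt_of_le i.isLt hn
  simp [this]

theorem blockWeights_take {n m : ℕ} (r : List Bool) {s k : ℕ} (h : (s + 1) * m ≤ k) :
    blockWeights n m (r.take k) s = blockWeights n m r s := by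
  rw [blockWeights, blockWeights]
  congr 2
  simp only [padTake]
  refine List.map_congr_left fun i hi => ?_
  rw [List.mem_range] at hi
  rw [add_mul, one_mul] at h
  simp [List.getD_eq_getElem?_getD, show s * m + i < k by omega]

/-- By `hG` the set depends only on the first `t * m` bits, whereas the weights of round `t` are the
next `m` bits. Conditioned on the past, the set is fixed and the previous lemma applies; the later
bits average out. -/
theorem coinAvg_maxCost_blockWeights {n m t T : ℕ} (hn : n ≤ 2 ^ m) (ht : t < T)
    (G : List Bool → Finset (Fin n)) (hG : ∀ r, G (r.take (t * m)) = G r) :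
    coinAvg (T * m) (fun r => maxCost (blockWeights n m r t) (G r)) =
      coinAvg (T * m) (fun r => ((G r).card : ℝ) / 2 ^ m) := by
  obtain ⟨b, rfl⟩ : ∃ b, T = t + (1 + b) := ⟨T - t - 1, by omega⟩
  rw [show (t + (1 + b)) * m = t * m + (m + b * m) by ring, coinAvg_add, coinAvg_add]
  refine coinAvg_congr fun r hr => ?_
  have e : ∀ r', G (r ++ r') = G r := fun r' => by
    rw [← hG, ← hr, List.take_left]
  simp only [e]
  rw [coinAvg_const, ← coinAvg_maxCost_oneHot hn, coinAvg_add]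
  refine coinAvg_congr fun r' hr' => ?_
  have h2 : ∀ r'', blockWeights n m (r ++ (r' ++ r'')) t = oneHot n (bitsVal r') := fun r'' => by
    rw [blockWeights, ← hr, List.drop_left, padTake_eq_take (by simp [hr']), ← hr', List.take_left]
  simp only [h2, coinAvg_const]

/-! ## Regret against random weights -/

namespace OnlineAlgorithm

theorem coinCount_mono (A : OnlineAlgorithm) (n : ℕ) (C : List Bool) {t T : ℕ} (h : t ≤ T) :
    A.coinCount n C t ≤ A.coinCount n C T :=
  Polynomial.eval_mono_nat _ (by omega)

/-- Causality: a move sees only the blocks of earlier rounds. This supplies the hypothesis `hG` of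
`coinAvg_maxCost_blockWeights`. -/
theorem play_blockWeights_take (A : OnlineAlgorithm) (n m : ℕ) (C : List Bool) (r wb : List Bool)
    (t : ℕ) : A.play n C (blockWeights n m (wb.take (t * m))) r t =
      A.play n C (blockWeights n m wb) r t := by
  rw [play, play]
  congr 2
  funext s
  exact blockWeights_take _ (Nat.mul_le_mul_right _ s.isLt)

theorem PlaysFeasible.play_mem {A : OnlineAlgorithm} {P : CardinalityProblem}
    (hA : A.PlaysFeasible P) {n : ℕ} {C : List Bool} (hf : P.Feasible n C)
    {w : ℕ → Fin n → ℚ≥0} (hw : ∀ t, Normalized (w t)) {r : List Bool} {t T : ℕ} (ht : t ≤ T)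
    (hr : r.length = A.coinCount n C T) : A.play n C w r t ∈ P n C := by
  have key : (⟨n, C, List.ofFn fun s : Fin t => w s, r.take (A.coinCount n C t)⟩ : Situation) ∈
      A.Admissible := by
    refine ⟨fun w' hw' => ?_, ?_⟩
    · obtain ⟨s, rfl⟩ := (List.mem_ofFn' _ _).1 hw'
      exact hw s
    · simp only [List.length_take, List.length_ofFn, hr]
      exact min_eq_left (A.coinCount_mono n C ht)
  exact hA _ key hf

/-- Small regret forces the moves to be small on average. -/
theorem sum_coinAvg_card_gt_le {A : OnlineAlgorithm} {P : CardinalityProblem}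
    (hA : A.PlaysFeasible P) {n : ℕ} {C : List Bool} {m k T : ℕ} (hn : n ≤ 2 ^ m)
    {S₀ : Finset (Fin n)} (hS₀ : S₀ ∈ P n C) (hk : S₀.card ≤ k) {R : ℝ}
    (hR : ∀ w : ℕ → Fin n → ℚ≥0, (∀ t, Normalized (w t)) → A.expectedRegret P n C w T ≤ R) :
    ∑ t ∈ Finset.range T, coinAvg (A.coinCount n C T) (fun r => coinAvg (T * m) (fun wb =>
      if (A.play n C (blockWeights n m wb) r t).card ≤ k then 0 else 1)) ≤ 2 ^ m * R := by
  have hf : P.Feasible n C := ⟨S₀, hS₀⟩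
  -- The comparison set must have minimum cardinality, so that the excess of every move over it is
  -- nonnegative; `S₀` itself need not be minimal.
  obtain ⟨S, hS, hmin⟩ : ∃ S ∈ P n C, ∀ S' ∈ P n C, S.card ≤ S'.card := by
    obtain ⟨S, hS, h⟩ := Set.exists_min_image (P n C) Finset.card (Set.toFinite _) hf
    exact ⟨S, hS, h⟩
  have hSk : S.card ≤ k := (hmin _ hS₀).trans hk
  set N := A.coinCount n C T with hN
  have hw : ∀ wb t, Normalized (blockWeights n m wb t) := fun wb t => normalized_oneHot _ _
  -- the cost of the algorithm against the cost of `S`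
  have h1 : coinAvg (T * m) (fun wb => coinAvg N (fun r => ∑ t ∈ Finset.range T,
      maxCost (blockWeights n m wb t) (A.play n C (blockWeights n m wb) r t))) ≤
      R + ∑ t ∈ Finset.range T, (S.card : ℝ) / 2 ^ m := by
    have h2 : ∀ wb : List Bool, wb.length = T * m → coinAvg N (fun r => ∑ t ∈ Finset.range T,
      maxCost (blockWeights n m wb t) (A.play n C (blockWeights n m wb) r t)) ≤
      R + ∑ t ∈ Finset.range T, maxCost (blockWeights n m wb t) S := by
      intro wb _
      have h3 := hR (blockWeights n m wb) (hw wb)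
      have h4 : (⨅ S : {S : Finset (Fin n) // S ∈ P n C},
          ∑ t ∈ Finset.range T, maxCost (blockWeights n m wb t) S.1) ≤
          ∑ t ∈ Finset.range T, maxCost (blockWeights n m wb t) S :=
        ciInf_le (Set.finite_range _).bddBelow (⟨S, hS⟩ : {S : Finset (Fin n) // S ∈ P n C})
      rw [expectedRegret] at h3
      simp only [coinAvg]
      linarith
    refine (coinAvg_mono h2).trans ?_
    rw [coinAvg_plus, coinAvg_const, coinAvg_sum]
    refine add_le_add_right (Finset.sum_le_sum fun t ht => le_of_eq ?_) _
    rw [coinAvg_maxCost_blockWeights hn (Finset.mem_range.1 ht) (fun _ => S) fun _ => rfl,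
      coinAvg_const]
  -- So far the weights were fixed outside and the algorithm's coins averaged inside, as the
  -- oblivious regret bound requires. Now the coins are fixed first, to use the randomness of the
  -- weights.
  rw [coinAvg_comm] at h1
  simp only [coinAvg_sum] at h1
  have h5 : ∀ t ∈ Finset.range T, coinAvg N (fun r => coinAvg (T * m) (fun wb =>
      maxCost (blockWeights n m wb t) (A.play n C (blockWeights n m wb) r t))) =
      coinAvg N (fun r => coinAvg (T * m) (fun wb =>
        ((A.play n C (blockWeights n m wb) r t).card : ℝ))) / 2 ^ m := by
    intro t ht
    rw [← coinAvg_div]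
    refine coinAvg_congr fun r _ => ?_
    rw [coinAvg_maxCost_blockWeights hn (Finset.mem_range.1 ht) _
      fun wb => A.play_blockWeights_take n m C r wb t, coinAvg_div]
  rw [Finset.sum_congr rfl h5, ← Finset.sum_div, ← Finset.sum_div] at h1
  have hM : (0 : ℝ) < 2 ^ m := by positivity
  -- The indicator of a large move is at most its excess over `S`: the excess is never negative, and
  -- it is at least `1` if the cardinality exceeds `k ≥ S.card`.
  have h6 : ∑ t ∈ Finset.range T, coinAvg N (fun r => coinAvg (T * m) (fun wb =>
      if (A.play n C (blockWeights n m wb) r t).card ≤ k then 0 else 1)) ≤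
      ∑ t ∈ Finset.range T, (coinAvg N (fun r => coinAvg (T * m) (fun wb =>
        ((A.play n C (blockWeights n m wb) r t).card : ℝ))) - S.card) := by
    refine Finset.sum_le_sum fun t ht => ?_
    rw [← coinAvg_const N (S.card : ℝ), ← coinAvg_sub]
    refine coinAvg_mono fun r hr => ?_
    rw [← coinAvg_const (T * m) (S.card : ℝ), ← coinAvg_sub]
    refine coinAvg_mono fun wb _ => ?_
    have h7 := hmin _ (hA.play_mem hf (hw wb) (Finset.mem_range.1 ht).le hr)
    have h7' : (S.card : ℝ) ≤ (A.play n C (blockWeights n m wb) r t).card := by exact_mod_cast h7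
    split_ifs with h8
    · linarith
    · have : S.card + 1 ≤ (A.play n C (blockWeights n m wb) r t).card := by omega
      have : (S.card : ℝ) + 1 ≤ (A.play n C (blockWeights n m wb) r t).card := by exact_mod_cast this
      linarith
  refine h6.trans ?_
  rw [Finset.sum_sub_distrib]
  have := mul_le_mul_of_nonneg_left h1 hM.le
  rw [mul_add, mul_div_cancel₀ _ hM.ne', mul_div_cancel₀ _ hM.ne'] at this
  linarith

/-! ### Sampling one uniformly random round -/

/-- The move in round `t` against random weights; the coins of the algorithm and then the weights
are read off `r`. -/
def moveAt (A : OnlineAlgorithm) (n : ℕ) (C : List Bool) (m t : ℕ) (r : List Bool) :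
    Finset (Fin n) :=
  A.act n C (List.ofFn fun s : Fin t => blockWeights n m (r.drop (A.coinCount n C t)) s)
    (padTake (A.coinCount n C t) r)

/-- The move in a random round, whose number is read off the first `l` bits of `r`. -/
def randomMove (A : OnlineAlgorithm) (n : ℕ) (C : List Bool) (m l : ℕ) (r : List Bool) :
    Finset (Fin n) :=
  A.moveAt n C m (bitsVal (padTake l r)) (r.drop l)

/-- The expected number of rounds with a move larger than `k` is at most `2 ^ m * R`, hence at most
half of the `2 ^ l` rounds by `hRl`. A uniformly random round is therefore good with probability at
least `1 / 2`. -/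
theorem half_le_coinAvg_randomMove {A : OnlineAlgorithm} {P : CardinalityProblem}
    (hA : A.PlaysFeasible P) {n : ℕ} {C : List Bool} {m k l : ℕ} (hn : n ≤ 2 ^ m)
    {S₀ : Finset (Fin n)} (hS₀ : S₀ ∈ P n C) (hk : S₀.card ≤ k) {R : ℝ}
    (hR : ∀ w : ℕ → Fin n → ℚ≥0, (∀ t, Normalized (w t)) →
      A.expectedRegret P n C w (2 ^ l) ≤ R) (hRl : 2 * (2 ^ m * R) ≤ 2 ^ l) {N : ℕ}
    (hN : l + A.coinCount n C (2 ^ l) + 2 ^ l * m ≤ N) :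
    1 / 2 ≤ coinAvg N (fun r => if (A.randomMove n C m l r).card ≤ k then 1 else 0) := by
  obtain ⟨b, rfl⟩ : ∃ b, N = l + b := ⟨N - l, by omega⟩
  let I : ℕ → List Bool → List Bool → ℝ := fun t c wb =>
    if (A.act n C (List.ofFn fun s : Fin t => blockWeights n m wb s) c).card ≤ k then 1 else 0
  have hI : ∀ t c wb, I t c (wb.take (t * m)) = I t c wb := by
    intro t c wb
    simp only [I]
    congr 5
    funext s
    exact blockWeights_take _ (Nat.mul_le_mul_right _ s.isLt)
  have h1 : coinAvg (l + b) (fun r => if (A.randomMove n C m l r).card ≤ k then 1 else 0) =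
      (∑ t ∈ Finset.range (2 ^ l), coinAvg b (fun r => I t (padTake (A.coinCount n C t) r)
        (r.drop (A.coinCount n C t)))) / 2 ^ l := by
    rw [coinAvg_add, ← coinAvg_bitsVal]
    refine coinAvg_congr fun r hr => coinAvg_congr fun r' _ => ?_
    rw [randomMove, padTake_eq_take (by simp [hr]), ← hr, List.take_left, List.drop_left]
    rfl
  -- In the sampled string the weight bits start right after the coins used in round `t`, whereas
  -- the play over all rounds has separate strings for coins and weights. Round `t` reads only
  -- prefixes of both, so discarding the unread coins with `coinAvg_take` gives the same average on
  -- both sides.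
  have h2 : ∀ t ∈ Finset.range (2 ^ l), coinAvg b (fun r => I t (padTake (A.coinCount n C t) r)
        (r.drop (A.coinCount n C t))) =
      1 - coinAvg (A.coinCount n C (2 ^ l)) (fun r => coinAvg (2 ^ l * m) (fun wb =>
      if (A.play n C (blockWeights n m wb) r t).card ≤ k then 0 else 1)) := by
    intro t ht
    rw [Finset.mem_range] at ht
    have hc := A.coinCount_mono n C ht.le
    have htm : t * m ≤ 2 ^ l * m := Nat.mul_le_mul_right _ ht.le
    obtain ⟨b', rfl⟩ : ∃ b', b = A.coinCount n C t + b' := ⟨b - A.coinCount n C t, by omega⟩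
    have e1 : coinAvg (A.coinCount n C t + b') (fun r => I t (padTake (A.coinCount n C t) r)
        (r.drop (A.coinCount n C t))) =
        coinAvg (A.coinCount n C t) (fun c => coinAvg (t * m) (I t c)) := by
      rw [coinAvg_add]
      refine coinAvg_congr fun c hc => ?_
      rw [← coinAvg_take (show t * m ≤ b' by omega)]
      refine coinAvg_congr fun wb _ => ?_
      rw [hI, padTake_eq_take (by simp [hc]), ← hc, List.take_left, List.drop_left]
    rw [e1, ← coinAvg_take hc, ← coinAvg_const (A.coinCount n C (2 ^ l)) 1, ← coinAvg_sub]
    refine coinAvg_congr fun r _ => ?_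
    rw [← coinAvg_take htm, ← coinAvg_const (2 ^ l * m) 1, ← coinAvg_sub]
    refine coinAvg_congr fun wb _ => ?_
    rw [hI]
    change (if (A.play n C (blockWeights n m wb) r t).card ≤ k then (1 : ℝ) else 0) = _
    by_cases h : (A.play n C (blockWeights n m wb) r t).card ≤ k
    · rw [if_pos h, if_pos h, sub_zero]
    · rw [if_neg h, if_neg h]
      simp only [coinAvg_const, sub_self]
  have h3 := sum_coinAvg_card_gt_le hA hn hS₀ hk hR
  rw [h1, Finset.sum_congr rfl h2, Finset.sum_sub_distrib, le_div_iff₀ (by positivity)]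
  simp only [Finset.sum_const, Finset.card_range, nsmul_eq_mul, mul_one]
  push_cast
  linarith

end OnlineAlgorithm

/-! ## Encodings of the moves and the weights -/

theorem count_encSet {n : ℕ} (S : Finset (Fin n)) : (encSet S).count true = S.card := by
  have h : S = Finset.univ.filter (· ∈ S) := by simp
  conv_rhs => rw [h]
  rw [encSet, List.ofFn_eq_map, List.count, List.countP_map, List.countP_eq_length_filter]
  simp only [Fin.univ_def, Finset.card, Finset.filter, Multiset.filter_coe, Multiset.coe_card]
  congr 2
  funext i
  simp

theorem encHistory_blockWeights (n m t : ℕ) (r : List Bool) :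
    encHistory (List.ofFn fun s : Fin t => blockWeights n m r s) = encOneHots n m t r := by
  -- The weights are `1 = 1/1` and `0 = 0/1`. The binary representation of `1` is `[true]`, that of
  -- `0` is empty and contributes only its terminator, which gives the blocks in `encOneHot`.
  have h1 : ∀ u, encList ((List.finRange n).flatMap fun i =>
      [Nat.bits (oneHot n u i).num, Nat.bits (oneHot n u i).den]) = encOneHot n u := by
    intro u
    rw [encList, List.flatMap_assoc, encOneHot, ← List.map_coe_finRange_eq_range, List.flatMap_map]
    congr 1
    funext i
    by_cases h : i.val = u <;> simp [oneHot, h]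
  rw [encHistory, encList, List.flatMap_assoc, encOneHots, List.ofFn_eq_map, List.flatMap_map,
    ← List.map_coe_finRange_eq_range, List.flatMap_map]
  congr 1
  funext s
  exact h1 _

/-- No condition on the length of `r` is needed: padding always supplies the exact number of coins,
and one-hot weights are normalized, so the situation is admissible. -/
theorem OnlineAlgorithm.PlaysFeasible.randomMove_mem {A : OnlineAlgorithm}
    {P : CardinalityProblem} (hA : A.PlaysFeasible P) {n : ℕ} {C : List Bool}
    (hf : P.Feasible n C) (m l : ℕ) (r : List Bool) : A.randomMove n C m l r ∈ P n C := by
  generalize ht : bitsVal (padTake l r) = t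
  have key : (⟨n, C, List.ofFn fun s : Fin t => blockWeights n m
      ((r.drop l).drop (A.coinCount n C t)) s, padTake (A.coinCount n C t) (r.drop l)⟩ :
      OnlineAlgorithm.Situation) ∈ A.Admissible := by
    refine ⟨fun w hw => ?_, by simp only [List.length_ofFn, length_padTake]⟩
    obtain ⟨s, rfl⟩ := (List.mem_ofFn' _ _).1 hw
    exact normalized_oneHot _ _
  have := hA _ key hf
  rw [OnlineAlgorithm.randomMove, ht]
  exact this

section
variable {α : Type} {D : Set α} {inp : α → List (List Bool)}

/-- `hl2` makes the number of simulated rounds polynomial; the history of the sampled round can then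
be written out and handed to the algorithm in a single call. -/
theorem PolyFun.randomMove {A : OnlineAlgorithm} (hA : A.PolyTime) {n m l : α → ℕ}
    {C r : α → List Bool} (hn : PolyNat D inp n) (hC : PolyFun D inp C) (hm : PolyNat D inp m)
    (hm2 : PolyNat D inp (fun a => 2 ^ m a)) (hl : PolyNat D inp l)
    (hl2 : PolyNat D inp (fun a => 2 ^ l a)) (hr : PolyFun D inp r) :
    PolyFun D inp (fun a => encSet (A.randomMove (n a) (C a) (m a) (l a) (r a))) := by
  let t : α → ℕ := fun a => bitsVal (_root_.padTake (l a) (r a))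
  let c : α → ℕ := fun a => A.coinCount (n a) (C a) (t a)
  have ht : PolyNat D inp t := PolyNat.bitsVal (PolyFun.padTake hl hr) hl2 fun a _ => by simp
  have hc : PolyNat D inp c := PolyNat.eval ((hn.add hC.ulength).add ht) A.coins
  have hr1 := PolyFun.drop hl hr
  have hr2 := PolyFun.drop hc hr1
  refine PolyFun.comp hA (fun a => (⟨n a, C a, List.ofFn fun s : Fin (t a) =>
      blockWeights (n a) (m a) (((r a).drop (l a)).drop (c a)) s,
      _root_.padTake (c a) ((r a).drop (l a))⟩ : OnlineAlgorithm.Situation))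
    [fun a => unary (n a), C, fun a => unary (t a),
      fun a => _root_.encOneHots (n a) (m a) (t a) (((r a).drop (l a)).drop (c a)),
      fun a => _root_.padTake (c a) ((r a).drop (l a))] hC.1 ?_ ?_ fun a _ => ?_
  · simp only [List.mem_cons, List.not_mem_nil, or_false, forall_eq_or_imp, forall_eq]
    exact ⟨hn, hC, ht, PolyFun.encOneHots hn hm hm2 ht hr2, PolyFun.padTake hc hr1⟩
  · refine fun a _ => ⟨fun w hw => ?_, by simp only [List.length_ofFn, length_padTake]; rfl⟩
    obtain ⟨s, rfl⟩ := (List.mem_ofFn' _ _).1 hw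
    exact normalized_oneHot _ _
  · simp only [List.length_ofFn, encHistory_blockWeights, List.map_cons, List.map_nil]

end

/-! ## The randomized test -/

/-- The size of the ground set of an encoded instance. -/
def parsedSize (y : List Bool) : ℕ := (decFirst y).length

/-- The constraints of an encoded instance. -/
def parsedConstraints (y : List Bool) : List Bool := decFirst (decRest y)

/-- The target cardinality of an encoded instance. -/
def parsedTarget (y : List Bool) : ℕ := (decFirst (decRest (decRest y))).length

/-- A random move of the online algorithm on an encoded instance. -/
def OnlineAlgorithm.sample (A : OnlineAlgorithm) (d : ℕ) (y r : List Bool) :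
    Finset (Fin (parsedSize y)) :=
  A.randomMove (parsedSize y) (parsedConstraints y) (Nat.clog 2 y.length)
    (d * Nat.clog 2 y.length) r

/-- Accept `y` if it encodes an instance of which the random move is a small feasible solution;
`chk` tests feasibility. -/
def OnlineAlgorithm.test (A : OnlineAlgorithm) (chk : (Σ n : ℕ, List Bool × Finset (Fin n)) → Bool)
    (d : ℕ) (y r : List Bool) : Bool :=
  decide (encList [unary (parsedSize y), parsedConstraints y, unary (parsedTarget y)] = y) &&
    (decide ((encSet (A.sample d y r)).count true ≤ parsedTarget y) &&
      chk ⟨parsedSize y, parsedConstraints y, A.sample d y r⟩)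

theorem parsed_encList (n : ℕ) (C : List Bool) (k : ℕ) :
    parsedSize (encList [unary n, C, unary k]) = n ∧
    parsedConstraints (encList [unary n, C, unary k]) = C ∧
    parsedTarget (encList [unary n, C, unary k]) = k := by
  simp [parsedSize, parsedConstraints, parsedTarget, decFirst_encList, decRest_encList]

section
variable {α : Type} {D : Set α} {inp : α → List (List Bool)} {y r : α → List Bool}

theorem PolyNat.parsedSize (hy : PolyFun D inp y) :
    PolyNat D inp (fun a => parsedSize (y a)) := hy.dec.1.ulength

theorem PolyFun.parsedConstraints (hy : PolyFun D inp y) :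
    PolyFun D inp (fun a => parsedConstraints (y a)) := hy.dec.2.dec.1

theorem PolyNat.parsedTarget (hy : PolyFun D inp y) :
    PolyNat D inp (fun a => parsedTarget (y a)) := hy.dec.2.dec.2.dec.1.ulength

theorem PolyNat.two_pow_mul_clog (hy : PolyFun D inp y) (d : ℕ) :
    PolyNat D inp (fun a => 2 ^ (d * Nat.clog 2 (y a).length)) := by
  simpa only [← pow_mul, mul_comm d] using (PolyNat.clog hy).1.pow d

theorem PolyFun.test {A : OnlineAlgorithm} (hA : A.PolyTime)
    {chk : (Σ n : ℕ, List Bool × Finset (Fin n)) → Bool}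
    (hchk : PolyTimeOn (Set.univ : Set (Σ n : ℕ, List Bool × Finset (Fin n)))
      (fun a => [unary a.1, a.2.1, encSet a.2.2]) (fun a => [chk a])) (d : ℕ)
    (hy : PolyFun D inp y) (hr : PolyFun D inp r) :
    PolyFun D inp (fun a => [A.test chk d (y a) (r a)]) := by
  have hn := PolyNat.parsedSize hy
  have hC := PolyFun.parsedConstraints hy
  have hk := PolyNat.parsedTarget hy
  obtain ⟨hM, hm⟩ := PolyNat.clog hy
  have hS : PolyFun D inp (fun a => encSet (A.sample d (y a) (r a))) :=
    PolyFun.randomMove hA hn hC hm hM ((PolyNat.const hy.1 d).mul hm)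
      (PolyNat.two_pow_mul_clog hy d) hr
  refine PolyFun.and (PolyFun.eq (PolyFun.encList_cons hn (PolyFun.encList_cons hC
    (PolyFun.encList_cons hk (PolyFun.nil hy.1)))) hy) (PolyFun.and (PolyFun.count_le hS hk) ?_)
  refine PolyFun.comp hchk (fun a => ⟨_root_.parsedSize (y a), _root_.parsedConstraints (y a),
    A.sample d (y a) (r a)⟩) [fun a => unary (_root_.parsedSize (y a)),
    fun a => _root_.parsedConstraints (y a), fun a => encSet (A.sample d (y a) (r a))] hy.1 ?_ (fun _ _ => Set.mem_univ _) fun _ _ => rfl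
  simp only [List.mem_cons, List.not_mem_nil, or_false, forall_eq_or_imp, forall_eq]
  exact ⟨hn, hC, hS⟩

end

/-! ## Growth -/

/-- For a monomial, `c * M ^ n ≤ M ^ (c + n)` because `c < 2 ^ c ≤ M ^ c`; a factor `2 ≤ M` absorbs
the sum of two powers. -/
theorem Polynomial.exists_eval_le_pow (p : Polynomial ℕ) :
    ∃ e : ℕ, ∀ M : ℕ, 2 ≤ M → p.eval M ≤ M ^ e := by
  induction p using Polynomial.induction_on' with
  | add p q hp hq =>
    obtain ⟨a, ha⟩ := hp
    obtain ⟨b, hb⟩ := hq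
    refine ⟨a + b + 1, fun M hM => ?_⟩
    have h1 : M ^ a ≤ M ^ (a + b) := Nat.pow_le_pow_right (by omega) (by omega)
    have h2 : M ^ b ≤ M ^ (a + b) := Nat.pow_le_pow_right (by omega) (by omega)
    have := ha M hM
    have := hb M hM
    have := Nat.mul_le_mul_left (M ^ (a + b)) hM
    rw [Polynomial.eval_add, pow_succ]
    omega
  | monomial n c =>
    refine ⟨c + n, fun M hM => ?_⟩
    rw [Polynomial.eval_monomial, pow_add]
    exact Nat.mul_le_mul_right _ (Nat.lt_two_pow_self.le.trans (Nat.pow_le_pow_left hM c))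

/-- Here `c < 1` enters: with `T = M ^ d` rounds, twice the bound `M p(M) T ^ c` is at most `M ^ (e
+ 2 + d c)`, and this is at most `T` once `d (1 - c) ≥ e + 2`. -/
theorem exists_pow_dominates (p : Polynomial ℕ) {c : ℝ} (hc : c < 1) :
    ∃ d : ℕ, ∀ M : ℕ, 2 ≤ M →
      2 * ((M : ℝ) * ((p.eval M : ℕ) * ((M ^ d : ℕ) : ℝ) ^ c)) ≤ (M : ℝ) ^ d := by
  obtain ⟨e, he⟩ := p.exists_eval_le_pow
  obtain ⟨d, hd⟩ := exists_nat_ge (((e : ℝ) + 2) / (1 - c))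
  rw [div_le_iff₀ (by linarith)] at hd
  refine ⟨d, fun M hM => ?_⟩
  have hM' : (2 : ℝ) ≤ M := by exact_mod_cast hM
  have hM0 : (0 : ℝ) < M := by linarith
  have h1 : ((p.eval M : ℕ) : ℝ) ≤ (M : ℝ) ^ e := by exact_mod_cast he M hM
  have h2 : ((M ^ d : ℕ) : ℝ) ^ c = (M : ℝ) ^ ((d : ℝ) * c) := by
    rw [Nat.cast_pow, ← Real.rpow_natCast, ← Real.rpow_mul hM0.le]
  rw [h2]
  have h3 : (0 : ℝ) ≤ (M : ℝ) ^ ((d : ℝ) * c) := by positivity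
  calc 2 * ((M : ℝ) * ((p.eval M : ℕ) * (M : ℝ) ^ ((d : ℝ) * c)))
      ≤ M * ((M : ℝ) * ((M : ℝ) ^ e * (M : ℝ) ^ ((d : ℝ) * c))) := by gcongr
    _ = (M : ℝ) ^ ((e : ℝ) + 2 + (d : ℝ) * c) := by
        rw [Real.rpow_add hM0, Real.rpow_add hM0, Real.rpow_natCast, Real.rpow_ofNat]
        ring
    _ ≤ (M : ℝ) ^ (d : ℝ) := Real.rpow_le_rpow_of_exponent_le (by linarith) (by linarith)
    _ = (M : ℝ) ^ d := Real.rpow_natCast _ _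

/-! ## The main theorem -/

/-- An accepting coin string is a certificate; one exists for every member because the density of
such strings is positive. -/
theorem RP_subset_NP : RP ⊆ NP := by
  rintro L ⟨V, p, hV, h⟩
  refine ⟨V, p, hV, fun x => ⟨fun hx => ?_, ?_⟩⟩
  · have h1 := (h x).1 hx
    by_contra hne
    push Not at hne
    rw [Finset.filter_false_of_mem fun r _ => hne r] at h1
    simp at h1
  · rintro ⟨y, hy⟩
    by_contra hx
    rw [(h x).2 hx y] at hy
    exact Bool.false_ne_true hy

/-- A randomized polynomial-time test for the decision problem. -/
theorem mem_RP_of_isPolyTimeVanishingRegret {P : CardinalityProblem}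
    (hfeas : (∀ (n : ℕ) (C : List Bool), P.Feasible n C) ∨ P.PolyTimeCheckable)
    {A : OnlineAlgorithm} (hA : A.IsPolyTimeVanishingRegret P) {L : Set (List Bool)}
    (hL : PolyTimeReduces L P.language) : L ∈ RP := by
  obtain ⟨hpoly, hplay, p, c, -, hc1, hreg⟩ := hA
  obtain ⟨f, hf, hfL⟩ := hL
  -- If all instances are feasible, then so are all moves and the trivial check suffices. Otherwise
  -- moves on infeasible instances are arbitrary and have to be tested.
  obtain ⟨chk, hchk, hchk1, hchk2⟩ : ∃ chk : (Σ n : ℕ, List Bool × Finset (Fin n)) → Bool,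
      PolyTimeOn (Set.univ : Set (Σ n : ℕ, List Bool × Finset (Fin n)))
        (fun a => [unary a.1, a.2.1, encSet a.2.2]) (fun a => [chk a]) ∧
      (∀ n C S, S ∈ P n C → chk ⟨n, C, S⟩ = true) ∧
      (∀ n C m l r, chk ⟨n, C, A.randomMove n C m l r⟩ = true →
        A.randomMove n C m l r ∈ P n C) := by
    rcases hfeas with h | h
    · exact ⟨fun _ => true, (PolyFun.const ⟨3, fun _ _ => rfl⟩ [true]).2, fun _ _ _ _ => rfl,
        fun n C m l r _ => hplay.randomMove_mem (h n C) m l r⟩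
    · classical
      refine ⟨fun a => decide (a.2.2 ∈ P a.1 a.2.1), ?_, fun n C S hS => by simpa using hS,
        fun n C m l r hS => by simpa using hS⟩
      rw [CardinalityProblem.PolyTimeCheckable] at h
      convert h
  obtain ⟨d, hd⟩ := exists_pow_dominates p hc1
  -- the number of coins
  have hk : ∃ k, ∀ x ∈ (Set.univ : Set (List Bool)), ([x] : List (List Bool)).length = k :=
    ⟨1, fun _ _ => rfl⟩
  have hy : PolyFun (Set.univ : Set (List Bool)) (fun x => [x]) f := ⟨hk, hf⟩
  -- The number of coins must be a polynomial in the length of `x` alone, whereas the demand depends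
  -- on the instance `f x`. An upper bound is enough, since surplus coins are ignored. The bound
  -- comes from computing the demand in unary.
  obtain ⟨q, hq⟩ : PolyBdd (Set.univ : Set (List Bool)) (fun x => [x]) (fun x =>
      d * Nat.clog 2 (f x).length + A.coinCount (parsedSize (f x)) (parsedConstraints (f x))
        (2 ^ (d * Nat.clog 2 (f x).length)) +
      2 ^ (d * Nat.clog 2 (f x).length) * Nat.clog 2 (f x).length) := by
    have hm := (PolyNat.clog hy).2
    have hT := PolyNat.two_pow_mul_clog hy d
    exact ((((PolyNat.const hk d).mul hm).add (PolyNat.eval (((PolyNat.parsedSize hy).add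
      (PolyFun.parsedConstraints hy).ulength).add hT) A.coins)).add (hT.mul hm)).bdd
  refine ⟨fun x r => A.test chk d (f x) r, q, ?_, fun x => ⟨fun hx => ?_, fun hx r => ?_⟩⟩
  · have hk2 : ∃ k, ∀ a ∈ (Set.univ : Set (List Bool × List Bool)),
        ([a.1, a.2] : List (List Bool)).length = k := ⟨2, fun _ _ => rfl⟩
    exact (PolyFun.test hpoly hchk d (PolyFun.comp₁ hf (PolyFun.input hk2 0))
      (PolyFun.input hk2 1)).2
  · obtain ⟨n, C, k, hfx, S₀, hS₀, hSk⟩ := (hfL x).1 hx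
    obtain ⟨e1, e2, e3⟩ := parsed_encList n C k
    rw [← hfx] at e1 e2 e3
    have hqx := hq x (Set.mem_univ _)
    simp only [inputSize, List.map_cons, List.map_nil, List.sum_cons, List.sum_nil,
      add_zero] at hqx
    have hlen : instanceSize n C ≤ (f x).length ∧ 2 ≤ (f x).length := by
      have h1 := length_le_encList_cons (unary n) [C, unary k]
      have h2 := length_le_encList_cons C [unary k]
      have h3 := length_le_encList_cons (unary k) []
      rw [← hfx, length_unary] at h1
      rw [instanceSize]
      omega
    set m := Nat.clog 2 (f x).length with hm
    have hM : (f x).length ≤ 2 ^ m := Nat.le_pow_clog (by norm_num) _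
    rw [e1, e2] at hqx
    have key := OnlineAlgorithm.half_le_coinAvg_randomMove hplay (m := m) (l := d * m)
      (le_trans (le_trans (Nat.le_add_right n C.length) hlen.1) hM) hS₀ hSk
      (R := ((p.eval (2 ^ m) : ℕ) : ℝ) * (((2 ^ m) ^ d : ℕ) : ℝ) ^ c) (fun w hw => by
        refine (hreg n C ⟨S₀, hS₀⟩ w hw _).trans ?_
        rw [mul_comm d m, pow_mul]
        have : p.eval (instanceSize n C) ≤ p.eval (2 ^ m) :=
          Polynomial.eval_mono_nat _ (hlen.1.trans hM)
        gcongr) (by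
        have := hd (2 ^ m) (hlen.2.trans hM)
        rw [mul_comm d m, pow_mul]
        exact_mod_cast this) hqx
    have hle : ∀ r : List Bool, r.length = q.eval x.length →
        (if (A.randomMove n C m (d * m) r).card ≤ k then (1 : ℝ) else 0) ≤
          if A.test chk d (f x) r = true then 1 else 0 := by
      intro r _
      by_cases hcard : (A.randomMove n C m (d * m) r).card ≤ k
      · rw [if_pos hcard, if_pos]
        have hmem := hplay.randomMove_mem ⟨S₀, hS₀⟩ m (d * m) r
        have hs : A.test chk d (f x) r = (decide (encList [unary n, C, unary k] = f x) &&
            (decide ((encSet (A.randomMove n C m (d * m) r)).count true ≤ k) &&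
              chk ⟨n, C, A.randomMove n C m (d * m) r⟩)) := by
          rw [OnlineAlgorithm.test, OnlineAlgorithm.sample, e1, e2, e3]
        rw [hs, count_encSet, hchk1 _ _ _ hmem]
        simp [hcard, hfx]
      · rw [if_neg hcard]
        split_ifs <;> simp
    have h4 := key.trans (coinAvg_mono hle)
    rw [coinAvg_indicator _ fun r => A.test chk d (f x) r = true] at h4
    have h5 : (((1 / 2 : ℚ≥0)) : ℝ) ≤ ((Finset.univ.filter fun r : Fin (q.eval x.length) → Bool =>
        A.test chk d (f x) (List.ofFn r) = true).dens : ℝ) := by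
      have h6 : (((1 / 2 : ℚ≥0)) : ℝ) = 1 / 2 := by norm_num
      rw [h6]
      exact h4
    exact_mod_cast h5
  -- Acceptance means that `f x` is a correct encoding and that the sampled set is feasible with at
  -- most the target number of elements; this set puts `f x` into the language.
  · by_contra hne
    simp only [Bool.not_eq_false, OnlineAlgorithm.test, Bool.and_eq_true, decide_eq_true_eq,
      count_encSet] at hne
    obtain ⟨h1, h2, h3⟩ := hne
    exact hx ((hfL x).2 ⟨_, _, _, h1.symm, _, hchk2 _ _ _ _ _ h3, h2⟩)

theorem mainTheorem3 (P : CardinalityProblem) (hP : NPComplete P.language)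
    (hfeas : (∀ (n : ℕ) (C : List Bool), P.Feasible n C) ∨ P.PolyTimeCheckable)
    (hne : NP ≠ RP) :
    ¬ ∃ A : OnlineAlgorithm, A.IsPolyTimeVanishingRegret P := by
  rintro ⟨A, hA⟩
  exact hne (Set.Subset.antisymm
    (fun L hL => mem_RP_of_isPolyTimeVanishingRegret hfeas hA (hP.2 L hL)) RP_subset_NP)
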